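/- Let $k \in \{2,3,4,5\}$ and let $G$ be a finite simple 3-connected cubic planar graph of circumference at least $k$, where the circumference is the length of a longest cycle of $G$. Then $G$ contains a cycle whose length lies in the interval $[k, 2k+2]$. -/

import Mathlib

namespace SimpleGraph

/-- The cycle spectrum of a graph: the set of the lengths of its cycles. -/
def cycleSpectrum {V : Type*} (G : SimpleGraph V) : Set ℕ :=
  {n | ∃ (v : V) (w : G.Walk v v), w.IsCycle ∧ w.length = n}

/-- The circumference of a graph: the supremum of the lengths of its cycles (in a finite graph with
a cycle, the length of a longest cycle; `0` for a graph without cycles). -/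
noncomputable def circumference {V : Type*} (G : SimpleGraph V) : ℕ∞ :=
  ⨆ n ∈ G.cycleSpectrum, (n : ℕ∞)

/-- A finite graph is `k`-connected if it has more than `k` vertices and deleting any set of fewer
than `k` vertices leaves a connected graph. -/
def IsKConnected {V : Type*} [Fintype V] (G : SimpleGraph V) (k : ℕ) : Prop :=
  k < Fintype.card V ∧
    ∀ S : Finset V, S.card < k → (G.induce {v : V | v ∉ S}).Connected

/-- `A` is a (simple, polygonal) arc in the plane with endpoints `x` and `y`: a chain of `n ≥ 1`
nondegenerate straight line segments leading from `x` to `y`, in which consecutive segments meet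
only in their common endpoint and any two other segments are disjoint. -/
def IsPolygonalArc (x y : ℝ × ℝ) (A : Set (ℝ × ℝ)) : Prop :=
  ∃ (n : ℕ) (p : ℕ → ℝ × ℝ), 0 < n ∧ p 0 = x ∧ p n = y ∧
    (∀ i < n, p i ≠ p (i + 1)) ∧
    (∀ i j : ℕ, i < j → j < n →
      ∀ z ∈ segment ℝ (p i) (p (i + 1)) ∩ segment ℝ (p j) (p (j + 1)), j = i + 1 ∧ z = p j) ∧
    A = ⋃ i < n, segment ℝ (p i) (p (i + 1))

/-- An embedding of a graph in the plane: the vertices are distinct points, every edge is an arc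
between its two ends, an edge passes through no vertex other than its ends, and two distinct edges
meet only in common ends. -/
structure PlaneEmbedding {V : Type*} (G : SimpleGraph V) where
  point : V → ℝ × ℝ
  arc : Sym2 V → Set (ℝ × ℝ)
  point_injective : Function.Injective point
  isArc : ∀ u v : V, G.Adj u v → IsPolygonalArc (point u) (point v) (arc s(u, v))
  point_mem_arc : ∀ (v : V), ∀ e ∈ G.edgeSet, point v ∈ arc e → v ∈ e
  arc_inter : ∀ e ∈ G.edgeSet, ∀ e' ∈ G.edgeSet, e ≠ e' →
    ∀ z ∈ arc e ∩ arc e', ∃ v : V, v ∈ e ∧ v ∈ e' ∧ z = point v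

/-- A (finite) graph is planar if it can be embedded in the plane. -/
def IsPlanar {V : Type*} (G : SimpleGraph V) : Prop :=
  Nonempty G.PlaneEmbedding

end SimpleGraph

/-! The proof is a discharging argument on Euler's inequality E + 2 ≤ V + F. A cubic graph has 2E =
3V, so the average face length is less than six. Suppose there is no cycle of length 5 or 6 and, if
there is one of length at most 4, none of length 5 to 10. Cycles of length at most 4 in two
different face boundaries share no edge, since their union would contain a diamond or a cycle of
length 5 or 6. So each short face owns at least three edges. On any other face the edges owned by
short faces form a matching; a cycle in its boundary has length at least 11 if short faces exist,
which leaves six edges not owned. Hence 6F ≤ 2E (`SideSystem.six_mul_card_le`), a contradiction.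
3-connectedness excludes bridges and, on at least five vertices, diamonds.

Faces are replaced by algebra over the field with two elements, with no Jordan curve theorem. A
point off the drawing defines a functional on the cycle space: the parity of the crossings of a
cycle with the upward vertical ray. The sides of an edge `e` are two such functionals that differ by
evaluation at `e`, and telescoping around a vertex shows that each functional is a side of evenly
many edges there (`PlaneSegments.IsCycle.sides`, `IsPlanar.exists_sides`). Evaluating cycles at all
sides is injective but never gives the constant 1, so there are more sides than dim ≥ E - V + 1
(`IsPlanar.exists_sideSystem`). -/

open Filter Topology

/-! ### Non-crossing segments and weight sums above a point -/

/-- A family of non-vertical straight line segments in the plane, given by their left and right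
ends, any two of which meet only in common ends. -/
structure PlaneSegments (T : Type*) where
  left : T → ℝ × ℝ
  right : T → ℝ × ℝ
  lt : ∀ t, (left t).1 < (right t).1
  inter : ∀ s t, s ≠ t → ∀ z ∈ segment ℝ (left s) (right s) ∩ segment ℝ (left t) (right t),
    (z = left s ∨ z = right s) ∧ (z = left t ∨ z = right t)

namespace PlaneSegments

variable {T M : Type*} (P : PlaneSegments T)

/-- The slope of a segment. -/
noncomputable def slope (t : T) : ℝ :=
  ((P.right t).2 - (P.left t).2) / ((P.right t).1 - (P.left t).1)

/-- The height at abscissa `x` of the line through a segment. -/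
noncomputable def height (t : T) (x : ℝ) : ℝ := (P.left t).2 + (x - (P.left t).1) * P.slope t

lemma height_left (t : T) : P.height t (P.left t).1 = (P.left t).2 := by
  simp [height]

lemma height_right (t : T) : P.height t (P.right t).1 = (P.right t).2 := by
  have := P.lt t
  have h : (P.right t).1 - (P.left t).1 ≠ 0 := by linarith
  simp only [height, slope]
  field_simp
  ring

lemma height_eq_add (t : T) (x x' : ℝ) :
    P.height t x' = P.height t x + (x' - x) * P.slope t := by
  simp only [height]; ring

lemma mem_segment {t : T} {x : ℝ} (h₁ : (P.left t).1 ≤ x) (h₂ : x ≤ (P.right t).1) :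
    (x, P.height t x) ∈ segment ℝ (P.left t) (P.right t) := by
  have := P.lt t
  have h : (0 : ℝ) < (P.right t).1 - (P.left t).1 := by linarith
  rw [segment_eq_image']
  refine ⟨(x - (P.left t).1) / ((P.right t).1 - (P.left t).1),
    ⟨div_nonneg (by linarith) h.le, (div_le_one h).2 (by linarith)⟩, ?_⟩
  ext
  · simp only [Prod.fst_add, Prod.smul_fst, Prod.fst_sub, smul_eq_mul]
    field_simp
    ring
  · simp only [Prod.snd_add, Prod.smul_snd, Prod.snd_sub, smul_eq_mul, height, slope]
    ring

lemma continuous_height (t : T) : Continuous (P.height t) := by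
  unfold height; fun_prop

lemma eq_left_of_height_eq {s t : T} (hst : s ≠ t) {x : ℝ} (hs : (P.left s).1 ≤ x)
    (hs' : x ≤ (P.right s).1) (ht : (P.left t).1 ≤ x) (ht' : x < (P.right t).1)
    (h : P.height s x = P.height t x) : P.left t = (x, P.height s x) := by
  have h₂ := P.mem_segment ht ht'.le
  rw [← h] at h₂
  rcases (P.inter s t hst _ ⟨P.mem_segment hs hs', h₂⟩).2 with h' | h'
  · exact h'.symm
  · rw [← h'] at ht'
    exact absurd ht' (lt_irrefl _)

lemma eq_right_of_height_eq {s t : T} (hst : s ≠ t) {x : ℝ} (hs : (P.left s).1 ≤ x)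
    (hs' : x ≤ (P.right s).1) (ht : (P.left t).1 < x) (ht' : x ≤ (P.right t).1)
    (h : P.height s x = P.height t x) : P.right t = (x, P.height s x) := by
  have h₂ := P.mem_segment ht.le ht'
  rw [← h] at h₂
  rcases (P.inter s t hst _ ⟨P.mem_segment hs hs', h₂⟩).2 with h' | h'
  · rw [← h'] at ht
    exact absurd ht (lt_irrefl _)
  · exact h'.symm

lemma slope_ne_of_left_eq {s t : T} (hst : s ≠ t) (h : P.left s = P.left t) :
    P.slope s ≠ P.slope t := by
  intro hsl
  obtain ⟨x, hx₁, hx₂⟩ := exists_between (lt_min (P.lt s) (h ▸ P.lt t))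
  have := lt_min_iff.1 hx₂
  have h' := P.eq_left_of_height_eq hst hx₁.le this.1.le (h ▸ hx₁.le) this.2
    (by simp only [height, h, hsl])
  rw [← h] at h'
  rw [h'] at hx₁
  exact lt_irrefl _ hx₁

lemma slope_ne_of_right_eq {s t : T} (hst : s ≠ t) (h : P.right s = P.right t) :
    P.slope s ≠ P.slope t := by
  intro hsl
  obtain ⟨x, hx₂, hx₁⟩ := exists_between (max_lt (P.lt s) (h ▸ P.lt t))
  have := max_lt_iff.1 hx₂
  have h' := P.eq_right_of_height_eq hst this.1.le hx₁.le this.2 (h ▸ hx₁.le) (by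
    rw [P.height_eq_add s (P.right s).1, P.height_eq_add t (P.right t).1, P.height_right,
      P.height_right, h, hsl])
  rw [← h] at h'
  rw [h'] at hx₁
  exact lt_irrefl _ hx₁

/-- Telescoping in characteristic 2: with `S` ordered by `k`, the partial sum at an element plus its
own value is the partial sum at the next lower element. For segments at a point ordered by slope,
this is a walk through the sectors between them. -/
lemma sum_partial_sums {κ : Type*} [LinearOrder κ] [AddCommGroup M] {v : T → M} (S : Finset T) (k : T → κ)
    (hk : Set.InjOn k S) (m : M) (F : M → ZMod 2) :
    ∑ s ∈ S, (F (m + ∑ t ∈ S with k s < k t, v t) + F (m + ∑ t ∈ S with k s < k t, v t + v s)) =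
      F m + F (m + ∑ s ∈ S, v s) := by
  classical
  induction S using Finset.induction_on_min_value k with
  | empty => simp [CharTwo.add_self_eq_zero]
  | insert a S ha hmin ih =>
    have hlt : ∀ x ∈ S, k a < k x := fun x hx => (hmin x hx).lt_of_ne fun h =>
      ha (hk (by simp) (by simp [hx]) h ▸ hx)
    rw [Finset.sum_insert ha, Finset.filter_insert, if_neg (lt_irrefl _),
      Finset.filter_true_of_mem hlt]
    have h₁ := ih (hk.mono (by simp))
    have h₂ : ∀ s ∈ S, (insert a S).filter (fun t => k s < k t) = S.filter (fun t => k s < k t) := by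
      intro s hs
      rw [Finset.filter_insert, if_neg (not_lt.2 (hmin s hs))]
    rw [Finset.sum_insert ha]
    have h₃ : ∑ s ∈ S, (F (m + ∑ t ∈ insert a S with k s < k t, v t) +
        F (m + ∑ t ∈ insert a S with k s < k t, v t + v s)) = F m + F (m + ∑ s ∈ S, v s) := by
      rw [← h₁]
      refine Finset.sum_congr rfl fun s hs => ?_
      rw [h₂ s hs]
    rw [h₃, add_comm (v a), ← add_assoc m]
    have := CharTwo.add_self_eq_zero (F (m + ∑ s ∈ S, v s))
    linear_combination this

section Finite

variable [Fintype T]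

open Classical in
/-- The segments that pass above the point `(x, y)` or start above it. -/
noncomputable def aboveR (x y : ℝ) : Finset T :=
  {t | (P.left t).1 ≤ x ∧ x < (P.right t).1 ∧ y < P.height t x}

open Classical in
/-- The segments that pass above the point `(x, y)` or end above it. -/
noncomputable def aboveL (x y : ℝ) : Finset T :=
  {t | (P.left t).1 < x ∧ x ≤ (P.right t).1 ∧ y < P.height t x}

open Classical in
-- Immediately to the right of `x₀`, the order relative to `s` can change only through segments that
-- start on `s` at `x₀`, and those lie above `s` exactly when they are steeper.
lemma eventually_aboveR {s : T} {x₀ : ℝ} (h₁ : (P.left s).1 ≤ x₀) (h₂ : x₀ < (P.right s).1) :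
    ∀ᶠ x in 𝓝[>] x₀, P.aboveR x (P.height s x) = P.aboveR x₀ (P.height s x₀) ∪
      ({t | P.left t = (x₀, P.height s x₀) ∧ P.slope s < P.slope t} : Finset T) := by
  have key : ∀ t : T, ∀ᶠ x in 𝓝[>] x₀,
      ((P.left t).1 ≤ x ∧ x < (P.right t).1 ∧ P.height s x < P.height t x ↔
        ((P.left t).1 ≤ x₀ ∧ x₀ < (P.right t).1 ∧ P.height s x₀ < P.height t x₀) ∨
          (P.left t = (x₀, P.height s x₀) ∧ P.slope s < P.slope t)) := by
    intro t
    have hpos : ∀ᶠ x in 𝓝[>] x₀, x₀ < x := self_mem_nhdsWithin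
    have hc := (P.continuous_height s).continuousWithinAt (s := Set.Ioi x₀) (x := x₀)
    have hc' := (P.continuous_height t).continuousWithinAt (s := Set.Ioi x₀) (x := x₀)
    have hid : Tendsto (fun x : ℝ => x) (𝓝[>] x₀) (𝓝 x₀) := tendsto_id.mono_left inf_le_left
    rcases lt_or_ge x₀ (P.left t).1 with ha | ha
    · filter_upwards [hid.eventually_lt_const ha] with x hx
      refine ⟨fun h => absurd h.1 (not_le.2 hx), ?_⟩
      rintro (h | h)
      · exact absurd h.1 (not_le.2 ha)
      · rw [h.1] at ha
        exact absurd ha (lt_irrefl _)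
    rcases lt_or_ge x₀ (P.right t).1 with hb | hb
    · rcases lt_trichotomy (P.height s x₀) (P.height t x₀) with h | h | h
      · filter_upwards [hid.eventually_lt_const hb, hpos, hc.eventually_lt hc' h] with x hx hx' hx''
        exact ⟨fun _ => Or.inl ⟨ha, hb, h⟩, fun _ => ⟨ha.trans hx'.le, hx, hx''⟩⟩
      · filter_upwards [hid.eventually_lt_const hb, hpos] with x hx hx'
        rw [P.height_eq_add s x₀, P.height_eq_add t x₀, h, add_lt_add_iff_left,
          mul_lt_mul_iff_right₀ (by linarith)]
        by_cases hst : s = t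
        · subst hst
          simp
        · have := P.eq_left_of_height_eq hst h₁ h₂.le ha hb h
          rw [h] at this
          simp [this, hx, hx'.le]
      · filter_upwards [hc'.eventually_lt hc h] with x hx
        refine ⟨fun h' => absurd h'.2.2 (not_lt.2 hx.le), ?_⟩
        rintro (h' | h')
        · exact absurd h'.2.2 (not_lt.2 h.le)
        · have := P.height_left t
          rw [h'.1] at this
          exact absurd h (by simp [this])
    · filter_upwards [hpos] with x hx
      refine ⟨fun h => absurd h.2.1 (not_lt.2 (hb.trans hx.le)), ?_⟩
      rintro (h | h)
      · exact absurd h.2.1 (not_lt.2 hb)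
      · have := P.lt t
        rw [h.1] at this
        exact absurd this (not_lt.2 hb)
  filter_upwards [eventually_all.2 key] with x hx
  ext t
  simpa [aboveR] using hx t

open Classical in
lemma eventually_aboveL {s : T} {x₀ : ℝ} (h₁ : (P.left s).1 < x₀) (h₂ : x₀ ≤ (P.right s).1) :
    ∀ᶠ x in 𝓝[<] x₀, P.aboveL x (P.height s x) = P.aboveL x₀ (P.height s x₀) ∪
      ({t | P.right t = (x₀, P.height s x₀) ∧ P.slope t < P.slope s} : Finset T) := by
  have key : ∀ t : T, ∀ᶠ x in 𝓝[<] x₀,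
      ((P.left t).1 < x ∧ x ≤ (P.right t).1 ∧ P.height s x < P.height t x ↔
        ((P.left t).1 < x₀ ∧ x₀ ≤ (P.right t).1 ∧ P.height s x₀ < P.height t x₀) ∨
          (P.right t = (x₀, P.height s x₀) ∧ P.slope t < P.slope s)) := by
    intro t
    have hpos : ∀ᶠ x in 𝓝[<] x₀, x < x₀ := self_mem_nhdsWithin
    have hc := (P.continuous_height s).continuousWithinAt (s := Set.Iio x₀) (x := x₀)
    have hc' := (P.continuous_height t).continuousWithinAt (s := Set.Iio x₀) (x := x₀)
    have hid : Tendsto (fun x : ℝ => x) (𝓝[<] x₀) (𝓝 x₀) := tendsto_id.mono_left inf_le_left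
    rcases lt_or_ge (P.right t).1 x₀ with hb | hb
    · filter_upwards [hid.eventually_const_lt hb] with x hx
      refine ⟨fun h => absurd h.2.1 (not_le.2 hx), ?_⟩
      rintro (h | h)
      · exact absurd h.2.1 (not_le.2 hb)
      · rw [h.1] at hb
        exact absurd hb (lt_irrefl _)
    rcases lt_or_ge (P.left t).1 x₀ with ha | ha
    · rcases lt_trichotomy (P.height s x₀) (P.height t x₀) with h | h | h
      · filter_upwards [hid.eventually_const_lt ha, hpos, hc.eventually_lt hc' h] with x hx hx' hx''
        exact ⟨fun _ => Or.inl ⟨ha, hb, h⟩, fun _ => ⟨hx, hx'.le.trans hb, hx''⟩⟩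
      · filter_upwards [hid.eventually_const_lt ha, hpos] with x hx hx'
        rw [P.height_eq_add s x₀, P.height_eq_add t x₀, h, add_lt_add_iff_left,
          mul_lt_mul_left_of_neg (by linarith)]
        by_cases hst : s = t
        · subst hst
          simp
        · have := P.eq_right_of_height_eq hst h₁.le h₂ ha hb h
          rw [h] at this
          simp [this, hx, hx'.le]
      · filter_upwards [hc'.eventually_lt hc h] with x hx
        refine ⟨fun h' => absurd h'.2.2 (not_lt.2 hx.le), ?_⟩
        rintro (h' | h')
        · exact absurd h'.2.2 (not_lt.2 h.le)
        · have := P.height_right t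
          rw [h'.1] at this
          exact absurd h (by simp [this])
    · filter_upwards [hpos] with x hx
      refine ⟨fun h => absurd h.1 (not_lt.2 (hx.le.trans ha)), ?_⟩
      rintro (h | h)
      · exact absurd h.1 (not_lt.2 ha)
      · have := P.lt t
        rw [h.1] at this
        exact absurd this (not_lt.2 ha)
  filter_upwards [eventually_all.2 key] with x hx
  ext t
  simpa [aboveL] using hx t

variable [AddCommGroup M] (v : T → M)

open Classical in
/-- A function on the segments is a cycle if its values at the segments ending in any point add up
to zero. -/
def IsCycle (v : T → M) : Prop :=
  ∀ q, ∑ t with P.left t = q, v t + ∑ t with P.right t = q, v t = 0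

variable {P v}

open Classical in
-- The two sets differ only in segments that end or start above the point on its vertical line;
-- grouped by their common endpoint, these contribute zero.
lemma IsCycle.sum_aboveL (hM : ∀ m : M, m + m = 0) (hv : P.IsCycle v) (x y : ℝ) :
    ∑ t ∈ P.aboveL x y, v t = ∑ t ∈ P.aboveR x y, v t := by
  set C : Finset T := {t | (P.left t).1 < x ∧ x < (P.right t).1 ∧ y < P.height t x} with hC
  set S : Finset T := {t | (P.left t).1 = x ∧ y < (P.left t).2} with hS
  set E : Finset T := {t | (P.right t).1 = x ∧ y < (P.right t).2} with hE
  have hR : P.aboveR x y = C ∪ S := by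
    ext t
    have := P.lt t
    simp only [aboveR, hC, hS, Finset.mem_filter, Finset.mem_univ, true_and, Finset.mem_union]
    constructor
    · rintro ⟨h₁, h₂, h₃⟩
      rcases h₁.lt_or_eq with h | h
      · exact Or.inl ⟨h, h₂, h₃⟩
      · exact Or.inr ⟨h, by rwa [← h, height_left] at h₃⟩
    · rintro (⟨h₁, h₂, h₃⟩ | ⟨h, h'⟩)
      · exact ⟨h₁.le, h₂, h₃⟩
      · exact ⟨h.le, h ▸ this, by rwa [← h, height_left]⟩
  have hL : P.aboveL x y = C ∪ E := by
    ext t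
    have := P.lt t
    simp only [aboveL, hC, hE, Finset.mem_filter, Finset.mem_univ, true_and, Finset.mem_union]
    constructor
    · rintro ⟨h₁, h₂, h₃⟩
      rcases h₂.lt_or_eq with h | h
      · exact Or.inl ⟨h₁, h, h₃⟩
      · exact Or.inr ⟨h.symm, by rwa [h, height_right] at h₃⟩
    · rintro (⟨h₁, h₂, h₃⟩ | ⟨h, h'⟩)
      · exact ⟨h₁, h₂.le, h₃⟩
      · exact ⟨h ▸ this, h.ge, by rwa [← h, height_right]⟩
  have dR : Disjoint C S := by
    rw [Finset.disjoint_filter]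
    rintro t - ⟨h, -⟩ ⟨h', -⟩
    exact h.ne h'
  have dL : Disjoint C E := by
    rw [Finset.disjoint_filter]
    rintro t - ⟨-, h, -⟩ ⟨h', -⟩
    exact h.ne h'.symm
  rw [hR, hL, Finset.sum_union dR, Finset.sum_union dL]
  congr 1
  set Q : Finset (ℝ × ℝ) := S.image P.left ∪ E.image P.right with hQ
  have hQ' : ∀ q ∈ Q, q.1 = x ∧ y < q.2 := by
    intro q hq
    simp only [hQ, hS, hE, Finset.mem_union, Finset.mem_image, Finset.mem_filter,
      Finset.mem_univ, true_and] at hq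
    rcases hq with ⟨t, h, rfl⟩ | ⟨t, h, rfl⟩ <;> exact h
  have h₁ : ∑ t ∈ S, v t = ∑ q ∈ Q, ∑ t with P.left t = q, v t := by
    rw [← Finset.sum_fiberwise_of_maps_to (g := P.left) (t := Q)
      (fun t ht => Finset.mem_union_left _ (Finset.mem_image_of_mem _ ht))]
    refine Finset.sum_congr rfl fun q hq => Finset.sum_congr ?_ fun _ _ => rfl
    ext t
    simp only [hS, Finset.mem_filter, Finset.mem_univ, true_and, and_iff_right_iff_imp]
    rintro rfl
    exact hQ' _ hq
  have h₂ : ∑ t ∈ E, v t = ∑ q ∈ Q, ∑ t with P.right t = q, v t := by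
    rw [← Finset.sum_fiberwise_of_maps_to (g := P.right) (t := Q)
      (fun t ht => Finset.mem_union_right _ (Finset.mem_image_of_mem _ ht))]
    refine Finset.sum_congr rfl fun q hq => Finset.sum_congr ?_ fun _ _ => rfl
    ext t
    simp only [hE, Finset.mem_filter, Finset.mem_univ, true_and, and_iff_right_iff_imp]
    rintro rfl
    exact hQ' _ hq
  have h₃ : ∑ t ∈ S, v t + ∑ t ∈ E, v t = 0 := by
    rw [h₁, h₂, ← Finset.sum_add_distrib]
    exact Finset.sum_eq_zero fun q _ => hv q
  rw [eq_neg_of_add_eq_zero_right h₃, neg_eq_of_add_eq_zero_left (hM _)]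

/-- The sum is locally constant along the open segment, hence constant by connectedness. -/
lemma IsCycle.sum_aboveR_eq (hM : ∀ m : M, m + m = 0) (hv : P.IsCycle v) (s : T) {x x' : ℝ}
    (hx : x ∈ Set.Ioo (P.left s).1 (P.right s).1) (hx' : x' ∈ Set.Ioo (P.left s).1 (P.right s).1) :
    ∑ t ∈ P.aboveR x (P.height s x), v t = ∑ t ∈ P.aboveR x' (P.height s x'), v t := by
  classical
  refine isPreconnected_Ioo.induction₂ (fun x x' => ∑ t ∈ P.aboveR x (P.height s x), v t =
    ∑ t ∈ P.aboveR x' (P.height s x'), v t) (fun x hx => ?_) (fun _ _ _ _ _ _ h h' => h.trans h')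
    (fun _ _ _ _ h => h.symm) hx hx'
  refine Filter.Eventually.filter_mono nhdsWithin_le_nhds ?_
  rw [← nhdsNE_sup_pure, ← nhdsLT_sup_nhdsGT, eventually_sup, eventually_sup]
  refine ⟨⟨?_, ?_⟩, rfl⟩
  · filter_upwards [P.eventually_aboveL hx.1 hx.2.le] with x' h
    rw [← hv.sum_aboveL hM, ← hv.sum_aboveL hM x', h]
    congr 1
    rw [Finset.left_eq_union]
    intro t ht
    -- A new segment would have an end in the interior of `s`.
    obtain ⟨-, h₁, h₂⟩ := Finset.mem_filter.1 ht
    exfalso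
    have hst : s ≠ t := by rintro rfl; exact lt_irrefl _ h₂
    have hm := P.mem_segment hx.1.le hx.2.le
    have := P.inter s t hst _ ⟨hm, h₁ ▸ right_mem_segment ℝ _ _⟩
    rcases this.1 with h | h
    · exact hx.1.ne (congrArg Prod.fst h).symm
    · exact hx.2.ne (congrArg Prod.fst h)
  · filter_upwards [P.eventually_aboveR hx.1.le hx.2] with x' h
    rw [h]
    congr 1
    rw [Finset.left_eq_union]
    intro t ht
    obtain ⟨-, h₁, h₂⟩ := Finset.mem_filter.1 ht
    exfalso
    have hst : s ≠ t := by rintro rfl; exact lt_irrefl _ h₂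
    have hm := P.mem_segment hx.1.le hx.2.le
    have := P.inter s t hst _ ⟨hm, h₁ ▸ left_mem_segment ℝ _ _⟩
    rcases this.1 with h | h
    · exact hx.1.ne (congrArg Prod.fst h).symm
    · exact hx.2.ne (congrArg Prod.fst h)

variable (P v) in
/-- The sum of the values of `v` at the segments above a given one. -/
noncomputable def top (s : T) : M :=
  ∑ t ∈ P.aboveR (((P.left s).1 + (P.right s).1) / 2)
    (P.height s (((P.left s).1 + (P.right s).1) / 2)), v t

lemma IsCycle.top_eq (hM : ∀ m : M, m + m = 0) (hv : P.IsCycle v) (s : T) {x : ℝ}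
    (hx : x ∈ Set.Ioo (P.left s).1 (P.right s).1) :
    P.top v s = ∑ t ∈ P.aboveR x (P.height s x), v t := by
  have := P.lt s
  exact hv.sum_aboveR_eq hM s ⟨by linarith, by linarith⟩ hx

open Classical in
lemma IsCycle.top_eq_left (hM : ∀ m : M, m + m = 0) (hv : P.IsCycle v) (s : T) :
    P.top v s = ∑ t ∈ P.aboveR (P.left s).1 (P.left s).2, v t +
      ∑ t with P.left t = P.left s ∧ P.slope s < P.slope t, v t := by
  obtain ⟨x, hx, hx'⟩ := ((P.eventually_aboveR le_rfl (P.lt s)).and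
    (Ioo_mem_nhdsGT (P.lt s))).exists
  rw [hv.top_eq hM s hx', hx, Finset.sum_union, height_left]
  rw [Finset.disjoint_left]
  intro t ht ht'
  simp only [aboveR, Finset.mem_filter, Finset.mem_univ, true_and, height_left] at ht ht'
  have := P.height_left t
  rw [ht'.1] at this
  simp [this] at ht

open Classical in
lemma IsCycle.top_eq_right (hM : ∀ m : M, m + m = 0) (hv : P.IsCycle v) (s : T) :
    P.top v s = ∑ t ∈ P.aboveR (P.right s).1 (P.right s).2, v t +
      ∑ t with P.right t = P.right s ∧ P.slope t < P.slope s, v t := by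
  obtain ⟨x, hx, hx'⟩ := ((P.eventually_aboveL (P.lt s) le_rfl).and
    (Ioo_mem_nhdsLT (P.lt s))).exists
  rw [hv.top_eq hM s hx', ← hv.sum_aboveL hM, ← hv.sum_aboveL hM, hx, Finset.sum_union,
    height_right]
  rw [Finset.disjoint_left]
  intro t ht ht'
  simp only [aboveL, Finset.mem_filter, Finset.mem_univ, true_and, height_right] at ht ht'
  have := P.height_right t
  rw [ht'.1] at this
  simp [this] at ht

open Classical in
/-- The sides of the segments at a point cancel in pairs. -/
theorem IsCycle.sides (hM : ∀ m : M, m + m = 0) (hv : P.IsCycle v) (φ : M) :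
    P.IsCycle fun s => ((if P.top v s = φ then 1 else 0) +
      (if P.top v s + v s = φ then 1 else 0) : ZMod 2) := by
  intro q
  have h₁ := sum_partial_sums (v := v) ({t | P.left t = q} : Finset T) P.slope (by
      intro s hs t ht h
      by_contra hst
      simp only [Finset.coe_filter, Finset.mem_univ, true_and, Set.mem_ofPred_eq] at hs ht
      exact P.slope_ne_of_left_eq hst (hs.trans ht.symm) h) (∑ t ∈ P.aboveR q.1 q.2, v t)
      (fun m => if m = φ then 1 else 0)
  -- To the left of `q` the upper segments have the smaller slopes, hence the sign.
  have h₂ := sum_partial_sums (v := v) ({t | P.right t = q} : Finset T) (fun t => -P.slope t) (by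
      intro s hs t ht h
      by_contra hst
      simp only [Finset.coe_filter, Finset.mem_univ, true_and, Set.mem_ofPred_eq] at hs ht
      exact P.slope_ne_of_right_eq hst (hs.trans ht.symm) (neg_injective h))
      (∑ t ∈ P.aboveR q.1 q.2, v t) (fun m => if m = φ then 1 else 0)
  have e₁ : ∀ s ∈ ({t | P.left t = q} : Finset T), P.top v s = ∑ t ∈ P.aboveR q.1 q.2, v t +
      ∑ t ∈ ({t | P.left t = q} : Finset T) with P.slope s < P.slope t, v t := by
    intro s hs
    simp only [Finset.mem_filter, Finset.mem_univ, true_and] at hs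
    rw [hv.top_eq_left hM, hs, Finset.filter_filter]
  have e₂ : ∀ s ∈ ({t | P.right t = q} : Finset T), P.top v s = ∑ t ∈ P.aboveR q.1 q.2, v t +
      ∑ t ∈ ({t | P.right t = q} : Finset T) with -P.slope s < -P.slope t, v t := by
    intro s hs
    simp only [Finset.mem_filter, Finset.mem_univ, true_and] at hs
    simp_rw [hv.top_eq_right hM, hs, Finset.filter_filter, neg_lt_neg_iff]
  have g₁ : ∑ t with P.left t = q, ((if P.top v t = φ then 1 else 0) +
      (if P.top v t + v t = φ then 1 else 0) : ZMod 2) = _ := Eq.trans (Finset.sum_congr rfl fun s hs => by simp only [e₁ s hs]) h₁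
  have g₂ : ∑ t with P.right t = q, ((if P.top v t = φ then 1 else 0) +
      (if P.top v t + v t = φ then 1 else 0) : ZMod 2) = _ := Eq.trans (Finset.sum_congr rfl fun s hs => by simp only [e₂ s hs]) h₂
  refine (congrArg₂ (· + ·) g₁ g₂).trans ?_
  -- The left and right fans both lead from the sector above `q` to the one below it. Their total
  -- weights agree by the cycle condition, so the two telescoped sums are equal and cancel.
  rw [eq_neg_of_add_eq_zero_left (hv q), neg_eq_of_add_eq_zero_left (hM _)]
  exact CharTwo.add_self_eq_zero _

end Finite

end PlaneSegments

/-! ### From segments to polygonal arcs -/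

/-- A finite family of polygonal arcs in the plane, each given by its sequence of corners, any two
of which meet only in common ends. -/
structure PolygonalArcs (ι : Type*) where
  len : ι → ℕ
  corner : ι → ℕ → ℝ × ℝ
  len_pos : ∀ e, 0 < len e
  corner_ne : ∀ e, ∀ i < len e, corner e i ≠ corner e (i + 1)
  self_inter : ∀ e, ∀ i j : ℕ, i < j → j < len e →
    ∀ z ∈ segment ℝ (corner e i) (corner e (i + 1)) ∩ segment ℝ (corner e j) (corner e (j + 1)),
      j = i + 1 ∧ z = corner e j
  inter : ∀ e e', e ≠ e' → ∀ i < len e, ∀ j < len e',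
    ∀ z ∈ segment ℝ (corner e i) (corner e (i + 1)) ∩ segment ℝ (corner e' j) (corner e' (j + 1)),
      (z = corner e 0 ∨ z = corner e (len e)) ∧ (z = corner e' 0 ∨ z = corner e' (len e'))

namespace PolygonalArcs

variable {ι M : Type*} (P : PolygonalArcs ι)

/-- The index type of the segments of a family of polygonal arcs. -/
abbrev Piece := Σ e : ι, Fin (P.len e)

lemma corner_injective (e : ι) {i j : ℕ} (hij : i < j) (hj : j ≤ P.len e) :
    P.corner e i ≠ P.corner e j := by
  intro h
  rcases (Nat.succ_le_of_lt hij).eq_or_lt with rfl | hij'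
  · exact P.corner_ne e i (by omega) h
  · obtain ⟨j, rfl⟩ : ∃ k, j = k + 1 := ⟨j - 1, by omega⟩
    have := P.self_inter e i j (by omega) (by omega) (P.corner e i)
      ⟨left_mem_segment ℝ _ _, h ▸ right_mem_segment ℝ _ _⟩
    obtain ⟨rfl, h'⟩ := this
    exact P.corner_ne e i (by omega) h'

lemma exists_corner_mem (e : ι) {i : ℕ} (hi : i ≤ P.len e) :
    ∃ j < P.len e, P.corner e i ∈ segment ℝ (P.corner e j) (P.corner e (j + 1)) := by
  rcases hi.lt_or_eq with h | rfl
  · exact ⟨i, h, left_mem_segment ℝ _ _⟩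
  · have := P.len_pos e
    refine ⟨P.len e - 1, by omega, ?_⟩
    rw [Nat.sub_add_cancel this]
    exact right_mem_segment ℝ _ _

lemma eq_of_corner_eq {e e' : ι} {i j : ℕ} (hj : 0 < j) (hj' : j < P.len e) (hi : i ≤ P.len e')
    (h : P.corner e' i = P.corner e j) : e' = e ∧ i = j := by
  by_cases he : e = e'
  · subst he
    refine ⟨rfl, ?_⟩
    rcases lt_trichotomy i j with hij | hij | hij
    · exact absurd h (P.corner_injective e hij hj'.le)
    · exact hij
    · exact absurd h.symm (P.corner_injective e hij hi)
  · obtain ⟨k, hk, hk'⟩ := P.exists_corner_mem e' hi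
    have := P.inter e e' he j hj' k hk (P.corner e j) ⟨left_mem_segment ℝ _ _, h ▸ hk'⟩
    rcases this.1 with h' | h'
    · exact absurd h'.symm (P.corner_injective e hj hj'.le)
    · exact absurd h' (P.corner_injective e hj' le_rfl)

lemma eq_corner_of_eq_end (e : ι) {i : ℕ} (hi : i < P.len e) {z : ℝ × ℝ}
    (hz : z ∈ segment ℝ (P.corner e i) (P.corner e (i + 1)))
    (h : z = P.corner e 0 ∨ z = P.corner e (P.len e)) :
    z = P.corner e i ∨ z = P.corner e (i + 1) := by
  have hpos := P.len_pos e
  rcases h with rfl | rfl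
  · rcases Nat.eq_zero_or_pos i with rfl | h0
    · exact Or.inl rfl
    · exact Or.inl (P.self_inter e 0 i h0 hi _ ⟨left_mem_segment ℝ _ _, hz⟩).2
  · rcases eq_or_ne (i + 1) (P.len e) with h0 | h0
    · exact Or.inr (by rw [h0])
    · have h1 : P.len e - 1 + 1 = P.len e := Nat.sub_add_cancel hpos
      have := P.self_inter e i (P.len e - 1) (by omega) (by omega) (P.corner e (P.len e))
        ⟨hz, by rw [h1]; exact right_mem_segment ℝ _ _⟩
      exact Or.inr (by rw [← this.1]; exact this.2)

open Classical in
/-- The segments of a family of polygonal arcs without vertical segments. -/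
noncomputable def toSegments (hP : ∀ e, ∀ i < P.len e, (P.corner e i).1 ≠ (P.corner e (i + 1)).1) :
    PlaneSegments P.Piece where
  left t := if (P.corner t.1 t.2).1 < (P.corner t.1 (t.2 + 1)).1 then P.corner t.1 t.2
    else P.corner t.1 (t.2 + 1)
  right t := if (P.corner t.1 t.2).1 < (P.corner t.1 (t.2 + 1)).1 then P.corner t.1 (t.2 + 1)
    else P.corner t.1 t.2
  lt t := by
    split_ifs with h
    · exact h
    · exact (not_lt.1 h).lt_of_ne (hP t.1 t.2 t.2.2).symm
  inter s t hst z hz := by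
    have hseg : ∀ (c : Prop) (x y : ℝ × ℝ),
        segment ℝ (if c then x else y) (if c then y else x) = segment ℝ x y := by
      intro c x y
      split_ifs
      · rfl
      · exact segment_symm ℝ _ _
    have hor : ∀ (c : Prop) (x y : ℝ × ℝ), (z = x ∨ z = y) →
        (z = (if c then x else y) ∨ z = (if c then y else x)) := by
      intro c x y h
      split_ifs
      · exact h
      · exact h.symm
    rw [hseg, hseg] at hz
    suffices h : (z = P.corner s.1 s.2 ∨ z = P.corner s.1 (s.2 + 1)) ∧
        (z = P.corner t.1 t.2 ∨ z = P.corner t.1 (t.2 + 1)) from ⟨hor _ _ _ h.1, hor _ _ _ h.2⟩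
    obtain ⟨e, i⟩ := s
    obtain ⟨e', j⟩ := t
    dsimp only at hz ⊢
    by_cases he : e = e'
    · subst he
      have hij : (i : ℕ) ≠ j := fun h => hst (by rw [Fin.ext h])
      rcases hij.lt_or_gt with h | h
      · obtain ⟨h1, h2⟩ := P.self_inter e i j h j.2 z hz
        exact ⟨Or.inr (h1 ▸ h2), Or.inl h2⟩
      · obtain ⟨h1, h2⟩ := P.self_inter e j i h i.2 z hz.symm
        exact ⟨Or.inl h2, Or.inr (h1 ▸ h2)⟩
    · have := P.inter e e' he i i.2 j j.2 z hz
      exact ⟨P.eq_corner_of_eq_end e i.2 hz.1 this.1, P.eq_corner_of_eq_end e' j.2 hz.2 this.2⟩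

variable [Fintype ι] [AddCommGroup M]

open Classical in
lemma isCycle_toSegments_iff {P : PolygonalArcs ι}
    {hP : ∀ e, ∀ i < P.len e, (P.corner e i).1 ≠ (P.corner e (i + 1)).1} {w : P.Piece → M} :
    (P.toSegments hP).IsCycle w ↔ ∀ q, ∑ t : P.Piece, ((if P.corner t.1 t.2 = q then w t else 0) +
      (if P.corner t.1 (t.2 + 1) = q then w t else 0)) = 0 := by
  unfold PlaneSegments.IsCycle
  refine forall_congr' fun q => ?_
  rw [Finset.sum_filter, Finset.sum_filter, ← Finset.sum_add_distrib]
  refine Eq.congr_left (Finset.sum_congr rfl fun t _ => ?_)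
  simp only [toSegments]
  by_cases h : (P.corner t.1 t.2).1 < (P.corner t.1 (t.2 + 1)).1
  · simp only [h, if_true]
  · simp only [h, if_false, add_comm]

open Classical in
-- With a constant weight along an arc, the contributions at inner corners cancel in pairs.
lemma sum_ends {P : PolygonalArcs ι} (hM : ∀ m : M, m + m = 0) (v : ι → M) (q : ℝ × ℝ) :
    ∑ t : P.Piece, ((if P.corner t.1 t.2 = q then v t.1 else 0) +
      (if P.corner t.1 (t.2 + 1) = q then v t.1 else 0)) =
    ∑ e with P.corner e 0 = q, v e + ∑ e with P.corner e (P.len e) = q, v e := by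
  rw [Fintype.sum_sigma, Finset.sum_filter, Finset.sum_filter, ← Finset.sum_add_distrib]
  refine Finset.sum_congr rfl fun e _ => ?_
  have key : ∀ n : ℕ, ∑ i ∈ Finset.range n, ((if P.corner e i = q then v e else 0) +
      (if P.corner e (i + 1) = q then v e else 0)) =
      (if P.corner e 0 = q then v e else 0) + (if P.corner e n = q then v e else 0) := by
    intro n
    induction n with
    | zero => simp [hM]
    | succ n ih =>
      rw [Finset.sum_range_succ, ih, ← add_assoc, add_assoc (if P.corner e 0 = q then v e else 0),
        hM, add_zero]
  rw [← key, ← Fin.sum_univ_eq_sum_range]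

/-- An inner corner lies on exactly two pieces, so a cycle takes equal values on them. -/
lemma eq_of_isCycle {hP : ∀ e, ∀ i < P.len e, (P.corner e i).1 ≠ (P.corner e (i + 1)).1}
    (hM : ∀ m : M, m + m = 0) {w : P.Piece → M} (hw : (P.toSegments hP).IsCycle w) (e : ι) {i : ℕ}
    (hi : i < P.len e) : w ⟨e, i, hi⟩ = w ⟨e, 0, P.len_pos e⟩ := by
  classical
  induction i with
  | zero => rfl
  | succ i ih =>
    rw [← ih (by omega)]
    have := isCycle_toSegments_iff.1 hw (P.corner e (i + 1))
    rw [Finset.sum_add_distrib, Finset.sum_eq_single ⟨e, i + 1, hi⟩,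
      Finset.sum_eq_single ⟨e, i, by omega⟩, if_pos rfl, if_pos rfl] at this
    · rw [eq_neg_of_add_eq_zero_left this, neg_eq_of_add_eq_zero_left (hM _)]
    · rintro ⟨e', j⟩ - h
      refine if_neg fun h' => h ?_
      obtain ⟨rfl, h2⟩ := P.eq_of_corner_eq (by omega) hi (by omega) h'
      congr
      ext
      simpa using h2
    · simp
    · rintro ⟨e', j⟩ - h
      refine if_neg fun h' => h ?_
      obtain ⟨rfl, h2⟩ := P.eq_of_corner_eq (by omega) hi (by omega) h'
      congr
      ext
      simpa using h2
    · simp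

open Classical in
lemma exists_sides_of_not_vertical
    (hP : ∀ e, ∀ i < P.len e, (P.corner e i).1 ≠ (P.corner e (i + 1)).1)
    (hM : ∀ m : M, m + m = 0) (v : ι → M)
    (hv : ∀ q, ∑ e with P.corner e 0 = q, v e + ∑ e with P.corner e (P.len e) = q, v e = 0) :
    ∃ A : ι → M, ∀ (φ : M) (q : ℝ × ℝ),
      ∑ e with P.corner e 0 = q, ((if A e = φ then 1 else 0) +
        (if A e + v e = φ then 1 else 0) : ZMod 2) +
      ∑ e with P.corner e (P.len e) = q, ((if A e = φ then 1 else 0) +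
        (if A e + v e = φ then 1 else 0) : ZMod 2) = 0 := by
  have hcyc : (P.toSegments hP).IsCycle fun t => v t.1 := by
    rw [isCycle_toSegments_iff]
    intro q
    rw [sum_ends hM, hv]
  refine ⟨fun e => (P.toSegments hP).top (fun t => v t.1) ⟨e, 0, P.len_pos e⟩, fun φ q => ?_⟩
  have hs := hcyc.sides hM φ
  -- The indicator of having side `φ` is itself a cycle, hence constant along each arc. So the first
  -- piece may stand for the whole arc.
  have hc := fun t : P.Piece => P.eq_of_isCycle CharTwo.add_self_eq_zero hs t.1 t.2.2
  rw [← sum_ends CharTwo.add_self_eq_zero]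
  refine Eq.trans (Finset.sum_congr rfl fun t _ => ?_) (isCycle_toSegments_iff.1 hs q)
  simp only [← hc t]

/-- The image of a family of polygonal arcs under an injective linear map. -/
noncomputable def map (f : ℝ × ℝ →ₗ[ℝ] ℝ × ℝ) (hf : Function.Injective f) : PolygonalArcs ι where
  len := P.len
  corner e i := f (P.corner e i)
  len_pos := P.len_pos
  corner_ne e i hi h := P.corner_ne e i hi (hf h)
  self_inter e i j hij hj z hz := by
    simp only [← f.coe_toAffineMap, ← image_segment] at hz
    rw [f.coe_toAffineMap, ← Set.image_inter hf] at hz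
    obtain ⟨z, hz, rfl⟩ := hz
    have := P.self_inter e i j hij hj z hz
    exact ⟨this.1, congrArg f this.2⟩
  inter e e' he i hi j hj z hz := by
    simp only [← f.coe_toAffineMap, ← image_segment] at hz
    rw [f.coe_toAffineMap, ← Set.image_inter hf] at hz
    obtain ⟨z, hz, rfl⟩ := hz
    have := P.inter e e' he i hi j hj z hz
    exact ⟨this.1.imp (congrArg f) (congrArg f), this.2.imp (congrArg f) (congrArg f)⟩

/-- Each piece becomes vertical for at most one value of `s`, and there are finitely many pieces. -/
lemma exists_shear : ∃ s : ℝ, ∀ e, ∀ i < P.len e,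
    (P.corner e i).1 + s * (P.corner e i).2 ≠
      (P.corner e (i + 1)).1 + s * (P.corner e (i + 1)).2 := by
  have hfin : (⋃ t : P.Piece, {s : ℝ | (P.corner t.1 t.2).1 + s * (P.corner t.1 t.2).2 =
      (P.corner t.1 (t.2 + 1)).1 + s * (P.corner t.1 (t.2 + 1)).2}).Finite := by
    refine Set.finite_iUnion fun t => Set.Subsingleton.finite ?_
    intro s hs s' hs'
    simp only [Set.mem_ofPred_eq] at hs hs'
    by_contra hss
    have h₂ : (P.corner t.1 t.2).2 = (P.corner t.1 (t.2 + 1)).2 := by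
      have h : (s - s') * ((P.corner t.1 t.2).2 - (P.corner t.1 (t.2 + 1)).2) = 0 := by
        linear_combination hs - hs'
      rcases mul_eq_zero.1 h with h | h
      · exact absurd (sub_eq_zero.1 h) hss
      · exact sub_eq_zero.1 h
    refine P.corner_ne t.1 t.2 t.2.2 (Prod.ext ?_ h₂)
    rw [h₂] at hs
    linarith
  obtain ⟨s, hs⟩ := hfin.exists_notMem
  refine ⟨s, fun e i hi h => hs ?_⟩
  exact Set.mem_iUnion.2 ⟨⟨e, i, hi⟩, h⟩

open Classical in
/-- To each arc of a family one can attach the two sides of the arc in such a way that, if the sum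
of the weights of the arcs ending in any point vanishes, the sides at any point cancel in pairs. -/
theorem exists_sides (hM : ∀ m : M, m + m = 0) (v : ι → M)
    (hv : ∀ q, ∑ e with P.corner e 0 = q, v e + ∑ e with P.corner e (P.len e) = q, v e = 0) :
    ∃ A : ι → M, ∀ (φ : M) (q : ℝ × ℝ),
      ∑ e with P.corner e 0 = q, ((if A e = φ then 1 else 0) +
        (if A e + v e = φ then 1 else 0) : ZMod 2) +
      ∑ e with P.corner e (P.len e) = q, ((if A e = φ then 1 else 0) +
        (if A e + v e = φ then 1 else 0) : ZMod 2) = 0 := by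
  obtain ⟨s, hs⟩ := P.exists_shear
  let f : ℝ × ℝ →ₗ[ℝ] ℝ × ℝ :=
    (LinearMap.fst ℝ ℝ ℝ + s • LinearMap.snd ℝ ℝ ℝ).prod (LinearMap.snd ℝ ℝ ℝ)
  have hf : Function.Bijective f := by
    refine Function.bijective_iff_has_inverse.2 ⟨fun z => (z.1 - s * z.2, z.2), fun z => ?_,
      fun z => ?_⟩ <;> ext <;> simp [f]
  obtain ⟨A, hA⟩ := (P.map f hf.1).exists_sides_of_not_vertical
    (fun e i hi h => hs e i hi (by simpa [f, map] using h)) hM v (by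
      intro q
      obtain ⟨q, rfl⟩ := hf.2 q
      simpa only [map, hf.1.eq_iff] using hv q)
  refine ⟨A, fun φ q => ?_⟩
  simpa only [map, hf.1.eq_iff] using hA φ (f q)

end PolygonalArcs

/-! ### The cycle space and the sides of the edges of a planar graph -/

namespace SimpleGraph

variable {V : Type*} (G : SimpleGraph V)

open Classical in
/-- The cycle space of a graph over the field with two elements. -/
noncomputable def cycleSpace [Fintype V] : Submodule (ZMod 2) (G.edgeSet → ZMod 2) where
  carrier := {z | ∀ v, ∑ e : G.edgeSet with v ∈ e.1, z e = 0}
  add_mem' {z z'} hz hz' v := by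
    simp only [Pi.add_apply, Finset.sum_add_distrib]
    rw [hz v, hz' v, add_zero]
  zero_mem' v := by simp
  smul_mem' c z hz v := by
    simp only [Pi.smul_apply, ← Finset.smul_sum]
    rw [hz v, smul_zero]

open Classical in
lemma mem_cycleSpace [Fintype V] {z : G.edgeSet → ZMod 2} :
    z ∈ G.cycleSpace ↔ ∀ v, ∑ e : G.edgeSet with v ∈ e.1, z e = 0 := Iff.rfl

/-- The evaluation of the elements of the cycle space at an edge. -/
noncomputable def cycleEval [Fintype V] (e : G.edgeSet) : G.cycleSpace →ₗ[ZMod 2] ZMod 2 :=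
  LinearMap.proj e ∘ₗ G.cycleSpace.subtype

@[simp]
lemma cycleEval_apply [Fintype V] (e : G.edgeSet) (z : G.cycleSpace) : G.cycleEval e z = z.1 e := rfl

variable {G}

lemma PlaneEmbedding.exists_polygonalArcs (E : G.PlaneEmbedding) :
    ∃ (P : PolygonalArcs G.edgeSet) (u w : G.edgeSet → V), ∀ e, e.1 = s(u e, w e) ∧
      P.corner e 0 = E.point (u e) ∧ P.corner e (P.len e) = E.point (w e) := by
  have h : ∀ e : G.edgeSet, ∃ u w : V, e.1 = s(u, w) ∧
      IsPolygonalArc (E.point u) (E.point w) (E.arc e.1) := by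
    rintro ⟨e, he⟩
    induction e using Sym2.ind with
    | _ u w => exact ⟨u, w, rfl, E.isArc u w he⟩
  choose u w he n p hn h0 h1 hne hself harc using h
  refine ⟨⟨n, p, hn, hne, hself, fun e e' hee i hi j hj z hz => ?_⟩, u, w,
    fun e => ⟨he e, h0 e, h1 e⟩⟩
  obtain ⟨v, hv, hv', rfl⟩ := E.arc_inter e.1 e.2 e'.1 e'.2 (fun h => hee (Subtype.ext h)) z
    ⟨by rw [harc]; exact Set.mem_biUnion hi hz.1, by rw [harc]; exact Set.mem_biUnion hj hz.2⟩
  rw [he, Sym2.mem_iff] at hv hv'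
  rw [h0, h1, h0, h1]
  exact ⟨hv.imp (congrArg _) (congrArg _), hv'.imp (congrArg _) (congrArg _)⟩

open Classical in
/-- Every edge of a planar graph has two sides, considered as functionals on the cycle space, which
differ by the evaluation at the edge, so that the sides at any vertex cancel in pairs. -/
theorem IsPlanar.exists_sides [Fintype V] (hG : G.IsPlanar) :
    ∃ A : G.edgeSet → G.cycleSpace →ₗ[ZMod 2] ZMod 2, ∀ φ v,
      ∑ e : G.edgeSet with v ∈ e.1, ((if A e = φ then 1 else 0) +
        (if A e + G.cycleEval e = φ then 1 else 0) : ZMod 2) = 0 := by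
  obtain ⟨E⟩ := hG
  obtain ⟨P, u, w, hP⟩ := E.exists_polygonalArcs
  have hu : ∀ v, ({e | P.corner e 0 = E.point v} : Finset G.edgeSet) ∪
      ({e | P.corner e (P.len e) = E.point v} : Finset G.edgeSet) =
        ({e | v ∈ e.1} : Finset G.edgeSet) := by
    intro v
    ext e
    have h := hP e
    simp only [Finset.mem_union, Finset.mem_filter, Finset.mem_univ, true_and, h.1, h.2.1, h.2.2,
      E.point_injective.eq_iff, Sym2.mem_iff, eq_comm]
  have hd : ∀ v, Disjoint ({e | P.corner e 0 = E.point v} : Finset G.edgeSet)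
      ({e | P.corner e (P.len e) = E.point v} : Finset G.edgeSet) := by
    intro v
    rw [Finset.disjoint_filter]
    intro e _ h1 h2
    have h := hP e
    rw [h.2.1] at h1
    rw [h.2.2] at h2
    have h3 := e.2
    rw [h.1, E.point_injective h1, E.point_injective h2] at h3
    exact G.loopless.irrefl v h3
  obtain ⟨A, hA⟩ := P.exists_sides (M := G.cycleSpace →ₗ[ZMod 2] ZMod 2)
    (fun m => by ext; simp [CharTwo.add_self_eq_zero]) G.cycleEval (by
      intro q
      by_cases hq : ∃ v, E.point v = q
      · obtain ⟨v, rfl⟩ := hq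
        rw [← Finset.sum_union (hd v), hu]
        -- For the weights `cycleEval`, the vanishing condition at a vertex is the definition of the
        -- cycle space.
        ext z
        simpa using z.2 v
      · rw [Finset.filter_false_of_mem, Finset.filter_false_of_mem]
        · simp
        · exact fun e _ h => hq ⟨w e, by rw [← (hP e).2.2, h]⟩
        · exact fun e _ h => hq ⟨u e, by rw [← (hP e).2.1, h]⟩)
  refine ⟨A, fun φ v => ?_⟩
  rw [← hu, Finset.sum_union (hd v)]
  convert hA φ (E.point v)

end SimpleGraph

/-! ### Euler's inequality by linear algebra -/

namespace SimpleGraph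

universe u

variable {V : Type u} [Fintype V] (G : SimpleGraph V)

open Classical in
lemma sum_incident_ite (e : G.edgeSet) (a : ZMod 2) : ∑ v, (if v ∈ e.1 then a else 0) = 0 := by
  obtain ⟨e, he⟩ := e
  induction e using Sym2.ind with
  | _ u w =>
    rw [← Finset.sum_filter]
    have : ({v | v ∈ s(u, w)} : Finset V) = {u, w} := by ext; simp
    rw [this, Finset.sum_pair (G.ne_of_adj he)]
    exact CharTwo.add_self_eq_zero a

open Classical in
/-- The dimension of the cycle space of a graph with a vertex is at least `E - V + 1`. -/
lemma card_edgeSet_lt_finrank_cycleSpace_add [Nonempty V] :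
    Nat.card G.edgeSet < Module.finrank (ZMod 2) G.cycleSpace + Fintype.card V := by
  let d : (G.edgeSet → ZMod 2) →ₗ[ZMod 2] (V → ZMod 2) :=
    { toFun := fun z v => ∑ e : G.edgeSet with v ∈ e.1, z e
      map_add' := fun z z' => by ext v; simp [Finset.sum_add_distrib]
      map_smul' := fun c z => by ext v; simp [Finset.mul_sum] }
  let σ : (V → ZMod 2) →ₗ[ZMod 2] ZMod 2 := ∑ v, LinearMap.proj v
  have hker : LinearMap.ker d = G.cycleSpace := by
    ext z
    simp only [LinearMap.mem_ker, mem_cycleSpace, funext_iff]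
    rfl
  -- The boundary map has rank at most V - 1, because the coordinates of a boundary add up to zero.
  have hle : LinearMap.range d ≤ LinearMap.ker σ := by
    rintro _ ⟨z, rfl⟩
    simp only [LinearMap.mem_ker, σ, d, LinearMap.sum_apply, LinearMap.proj_apply,
      LinearMap.coe_mk, AddHom.coe_mk, Finset.sum_filter]
    rw [Finset.sum_comm]
    exact Finset.sum_eq_zero fun e _ => G.sum_incident_ite e (z e)
  have hne : LinearMap.ker σ ≠ ⊤ := by
    intro h
    obtain ⟨v⟩ := ‹Nonempty V›
    have : Pi.single v 1 ∈ LinearMap.ker σ := h ▸ Submodule.mem_top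
    simp [σ] at this
  have h₁ := LinearMap.finrank_range_add_finrank_ker d
  have h₂ := (Submodule.finrank_mono hle).trans_lt (Submodule.finrank_lt hne)
  rw [hker, Module.finrank_fintype_fun_eq_card] at h₁
  rw [Module.finrank_fintype_fun_eq_card] at h₂
  rw [Nat.card_eq_fintype_card]
  omega

/-- A finite set of functionals on the cycle space which, together with their pairwise differences,
yields all evaluations at edges has more elements than the dimension of the cycle space. -/
lemma finrank_cycleSpace_lt_card {Φ : Finset (G.cycleSpace →ₗ[ZMod 2] ZMod 2)}
    (hne : Φ.Nonempty)
    (hΦ : ∀ e, ∃ φ ∈ Φ, ∃ ψ ∈ Φ, φ + ψ = G.cycleEval e) :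
    Module.finrank (ZMod 2) G.cycleSpace < Φ.card := by
  have hzero : ∀ (z : G.cycleSpace) (c : ZMod 2), (∀ φ ∈ Φ, φ z = c) → z = 0 := by
    intro z c hz
    ext e
    obtain ⟨φ, hφ, ψ, hψ, h⟩ := hΦ e
    rw [← cycleEval_apply, ← h, LinearMap.add_apply, hz φ hφ, hz ψ hψ]
    exact CharTwo.add_self_eq_zero c
  let ev : G.cycleSpace →ₗ[ZMod 2] (Φ → ZMod 2) := LinearMap.pi fun φ => φ.1
  have hinj : Function.Injective ev := by
    rw [injective_iff_map_eq_zero]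
    exact fun z hz => hzero z 0 fun φ hφ => congrFun hz ⟨φ, hφ⟩
  -- A cycle on which all functionals take the same value `c` has value `c + c = 0` at every edge.
  -- Thus `ev` is injective, and the constant 1 is not attained.
  have hrange : LinearMap.range ev ≠ ⊤ := by
    intro h
    obtain ⟨z, hz⟩ : (fun _ => 1) ∈ LinearMap.range ev := h ▸ Submodule.mem_top
    have hz0 := hzero z 1 fun φ hφ => congrFun hz ⟨φ, hφ⟩
    obtain ⟨φ, hφ⟩ := hne
    have h1 : φ z = 1 := congrFun hz ⟨φ, hφ⟩
    rw [hz0, map_zero] at h1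
    exact zero_ne_one h1
  have := Submodule.finrank_lt hrange
  rwa [LinearMap.finrank_range_of_inj hinj, Module.finrank_fintype_fun_eq_card,
    Fintype.card_coe] at this

open Classical in
/-- The edge set of a cycle as an element of the cycle space. -/
lemma Walk.IsCycle.mem_cycleSpace {G : SimpleGraph V} {u : V} {w : G.Walk u u} (hw : w.IsCycle) :
    (fun e : G.edgeSet => if e.1 ∈ w.edges then (1 : ZMod 2) else 0) ∈ G.cycleSpace := by
  rw [SimpleGraph.mem_cycleSpace]
  intro v
  have h := (hw.isTrail.even_countP_edges_iff v).2 (fun h => absurd rfl h)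
  rw [Finset.sum_boole, ZMod.natCast_eq_zero_iff_even]
  convert h using 1
  rw [List.countP_eq_length_filter, ← List.toFinset_card_of_nodup (hw.edges_nodup.filter _),
    Finset.filter_filter]
  refine Finset.card_bij (fun e _ => e.1) (fun e he => ?_) (fun _ _ _ _ h => Subtype.ext h)
    (fun e he => ?_)
  · simpa [and_comm] using he
  · simp only [List.mem_toFinset, List.mem_filter, decide_eq_true_eq] at he
    exact ⟨⟨e, w.edges_subset_edgeSet he.1⟩, by simpa [and_comm] using he, rfl⟩

/-- An assignment of two sides to every edge of a graph, such that each side lies at an even number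
of edges at each vertex. -/
structure SideSystem (G : SimpleGraph V) (M : Type*) where
  sides : Sym2 V → Finset M
  card_sides : ∀ e ∈ G.edgeSet, (sides e).card = 2
  even : ∀ v φ, Even {x | G.Adj v x ∧ φ ∈ sides s(v, x)}.ncard

open Classical in
/-- In a planar graph without bridges, the edges have sides of which there are at least
`E - V + 2`. -/
theorem IsPlanar.exists_sideSystem {G : SimpleGraph V} (hG : G.IsPlanar)
    (hb : ∀ e ∈ G.edgeSet, ¬ G.IsBridge e) (he : G.edgeSet.Nonempty) :
    ∃ (M : Type u) (S : G.SideSystem M) (Φ : Finset M),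
      (∀ e ∈ G.edgeSet, S.sides e ⊆ Φ) ∧ (∀ φ ∈ Φ, ∃ e ∈ G.edgeSet, φ ∈ S.sides e) ∧
      Nat.card G.edgeSet + 2 ≤ Fintype.card V + Φ.card := by
  obtain ⟨A, hA⟩ := hG.exists_sides
  -- Since `e` is not a bridge, some cycle passes through it; so its two sides differ.
  have hev : ∀ e, G.cycleEval e ≠ 0 := by
    intro e h
    have := hb e.1 e.2
    rw [isBridge_iff_forall_cycle_notMem e.2] at this
    push Not at this
    obtain ⟨u, w, hw, hew⟩ := this
    have h1 := LinearMap.congr_fun h ⟨_, hw.mem_cycleSpace⟩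
    simp [hew] at h1
  have hne : ∀ e, A e ≠ A e + G.cycleEval e := fun e h => hev e (left_eq_add.1 h)
  let F : Sym2 V → Finset (G.cycleSpace →ₗ[ZMod 2] ZMod 2) := fun e =>
    if h : e ∈ G.edgeSet then {A ⟨e, h⟩, A ⟨e, h⟩ + G.cycleEval ⟨e, h⟩} else ∅
  have hF : ∀ e : G.edgeSet, F e.1 = {A e, A e + G.cycleEval e} := fun e => dif_pos e.2
  obtain ⟨Φ, hΦ⟩ : ∃ Φ : Finset (G.cycleSpace →ₗ[ZMod 2] ZMod 2),
      ∀ φ, φ ∈ Φ ↔ ∃ e : G.edgeSet, φ ∈ F e.1 :=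
    ⟨Finset.univ.biUnion fun e : G.edgeSet => F e.1, by simp⟩
  have hmem : ∀ e, A e ∈ Φ ∧ A e + G.cycleEval e ∈ Φ := fun e =>
    ⟨(hΦ _).2 ⟨e, by simp [hF]⟩, (hΦ _).2 ⟨e, by simp [hF]⟩⟩
  have hd : ∀ e : G.edgeSet, A e + (A e + G.cycleEval e) = G.cycleEval e := by
    intro e
    ext z
    simp only [LinearMap.add_apply, ← add_assoc]
    rw [CharTwo.add_self_eq_zero, zero_add]
  have h2 : Module.finrank (ZMod 2) G.cycleSpace < Φ.card := by
    refine G.finrank_cycleSpace_lt_card ?_ fun e => ?_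
    · obtain ⟨e, he⟩ := he
      exact ⟨_, (hmem ⟨e, he⟩).1⟩
    · exact ⟨A e, (hmem e).1, A e + G.cycleEval e, (hmem e).2, hd e⟩
  have hlt : Nat.card G.edgeSet + 2 ≤ Fintype.card V + Φ.card := by
    have : Nonempty V := by
      obtain ⟨e, he⟩ := he
      induction e using Sym2.ind with
      | _ u w => exact ⟨u⟩
    have h1 := G.card_edgeSet_lt_finrank_cycleSpace_add
    omega
  have heven : ∀ v φ, Even {x | G.Adj v x ∧ φ ∈ F s(v, x)}.ncard := by
    intro v φ
    have h := hA φ v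
    have h' : ∀ e : G.edgeSet, ((if A e = φ then 1 else 0) +
        (if A e + G.cycleEval e = φ then 1 else 0) : ZMod 2) = if φ ∈ F e.1 then 1 else 0 := by
      intro e
      have hm : φ ∈ F e.1 ↔ φ = A e ∨ φ = A e + G.cycleEval e := by simp [hF]
      simp only [hm]
      by_cases h1 : A e = φ
      · have h2 : A e + G.cycleEval e ≠ φ := fun h2 => hne e (h1.trans h2.symm)
        rw [if_pos h1, if_neg h2, if_pos (Or.inl h1.symm), add_zero]
      · by_cases h2 : A e + G.cycleEval e = φ
        · rw [if_neg h1, if_pos h2, if_pos (Or.inr h2.symm), zero_add]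
        · rw [if_neg h1, if_neg h2, if_neg (by rintro (h | h) <;> simp_all), add_zero]
    rw [Finset.sum_congr rfl fun e _ => h' e, Finset.sum_boole, ZMod.natCast_eq_zero_iff_even,
      Finset.filter_filter] at h
    convert h using 1
    rw [Set.ncard_eq_toFinset_card']
    refine Finset.card_bij (fun x hx => ⟨s(v, x), (by simpa using hx : _ ∧ _).1⟩) (fun x hx => ?_)
      (fun x _ y _ h => ?_) (fun e he => ?_)
    · simpa using (by simpa using hx : _ ∧ _).2
    · exact Sym2.congr_right.1 (Subtype.ext_iff.1 h)
    · obtain ⟨e, he'⟩ := e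
      simp only [Finset.mem_filter, Finset.mem_univ, true_and] at he
      obtain ⟨x, rfl⟩ := Sym2.mem_iff_exists.1 he.1
      exact ⟨x, by simpa using ⟨he', he.2⟩, rfl⟩
  refine ⟨_, ⟨F, fun e he => ?_, heven⟩, Φ, fun e he φ hφ => (hΦ φ).2 ⟨⟨e, he⟩, hφ⟩,
    fun φ hφ => ?_, hlt⟩
  · rw [hF ⟨e, he⟩]
    exact Finset.card_pair (hne _)
  · obtain ⟨e, he⟩ := (hΦ φ).1 hφ
    exact ⟨e.1, e.2, he⟩

end SimpleGraph

/-! ### Boundaries and short cycles in cubic graphs -/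

namespace SimpleGraph

universe u

variable {V : Type u} {G : SimpleGraph V}

lemma exists_third_neighbor (h3 : ∀ v, (G.neighborSet v).ncard = 3) {v x y : V} (hx : G.Adj v x)
    (hy : G.Adj v y) (hxy : x ≠ y) :
    ∃ z, z ≠ x ∧ z ≠ y ∧ ∀ w, G.Adj v w ↔ w = x ∨ w = y ∨ w = z := by
  obtain ⟨a, b, c, hab, hac, hbc, h⟩ := Set.ncard_eq_three.1 (h3 v)
  have h' : ∀ w, G.Adj v w ↔ w = a ∨ w = b ∨ w = c := fun w => by
    rw [← mem_neighborSet, h]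
    simp
  simp only [h'] at hx hy ⊢
  rcases hx with rfl | rfl | rfl <;> rcases hy with rfl | rfl | rfl <;> try exact absurd rfl hxy
  · exact ⟨c, hac.symm, hbc.symm, fun w => by tauto⟩
  · exact ⟨b, hab.symm, hbc, fun w => by tauto⟩
  · exact ⟨c, hbc.symm, hac.symm, fun w => by tauto⟩
  · exact ⟨a, hab, hac, fun w => by tauto⟩
  · exact ⟨b, hbc, hab.symm, fun w => by tauto⟩
  · exact ⟨a, hac, hab, fun w => by tauto⟩

/-- `T` consists of the edges of a cycle of length `3` or `4` through the edge `ab`. -/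
def IsShortCycleAt (G : SimpleGraph V) [DecidableEq V] (T : Finset (Sym2 V)) (a b : V) : Prop :=
  (∃ c, G.Adj a b ∧ G.Adj b c ∧ G.Adj c a ∧ T = {s(a, b), s(b, c), s(c, a)}) ∨
  ∃ c d, a ≠ c ∧ b ≠ d ∧ G.Adj a b ∧ G.Adj b c ∧ G.Adj c d ∧ G.Adj d a ∧
    T = {s(a, b), s(b, c), s(c, d), s(d, a)}

lemma IsShortCycleAt.exists_ne [DecidableEq V] {T : Finset (Sym2 V)} {a b : V}
    (h : G.IsShortCycleAt T a b) : ∃ c, c ≠ b ∧ G.Adj a c ∧ s(a, c) ∈ T := by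
  rcases h with ⟨c, -, h1, h2, rfl⟩ | ⟨c, d, -, h1, -, -, -, h2, rfl⟩
  · exact ⟨c, h1.ne', h2.symm, by simp [Sym2.eq_swap]⟩
  · exact ⟨d, h1.symm, h2.symm, by simp [Sym2.eq_swap]⟩

lemma Walk.IsCycle.isShortCycleAt [DecidableEq V] {u : V} {w : G.Walk u u} (hw : w.IsCycle)
    (hl : w.length ≤ 4) {a b : V} (hab : s(a, b) ∈ w.edges) :
    G.IsShortCycleAt w.edges.toFinset a b := by
  have h3 := hw.three_le_length
  match w, hw, hl, hab, h3 with
  | .cons h₁ (.cons h₂ (.cons h₃ .nil)), hw, _, hab, _ =>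
    left
    simp only [Walk.edges_cons, Walk.edges_nil, List.mem_cons, List.not_mem_nil, or_false,
      Sym2.eq_iff] at hab
    rcases hab with (⟨rfl, rfl⟩ | ⟨rfl, rfl⟩) | (⟨rfl, rfl⟩ | ⟨rfl, rfl⟩) |
      (⟨rfl, rfl⟩ | ⟨rfl, rfl⟩)
    · exact ⟨_, h₁, h₂, h₃, by ext; simp⟩
    · exact ⟨_, h₁.symm, h₃.symm, h₂.symm, by ext; simp [Sym2.eq_swap]; tauto⟩
    · exact ⟨_, h₂, h₃, h₁, by ext; simp; tauto⟩
    · exact ⟨_, h₂.symm, h₁.symm, h₃.symm, by ext; simp [Sym2.eq_swap]; tauto⟩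
    · exact ⟨_, h₃, h₁, h₂, by ext; simp; tauto⟩
    · exact ⟨_, h₃.symm, h₂.symm, h₁.symm, by ext; simp [Sym2.eq_swap]; tauto⟩
  | .cons (v := p) h₁ (.cons (v := q) h₂ (.cons (v := r) h₃ (.cons h₄ .nil))), hw, _, hab, _ =>
    right
    have hne : u ≠ q ∧ p ≠ r := by
      have := hw.support_nodup
      simp at this
      exact ⟨fun h => this.2.1.2 h.symm, this.1.2.1⟩
    simp only [Walk.edges_cons, Walk.edges_nil, List.mem_cons, List.not_mem_nil, or_false,
      Sym2.eq_iff] at hab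
    rcases hab with (⟨rfl, rfl⟩ | ⟨rfl, rfl⟩) | (⟨rfl, rfl⟩ | ⟨rfl, rfl⟩) |
      (⟨rfl, rfl⟩ | ⟨rfl, rfl⟩) | (⟨rfl, rfl⟩ | ⟨rfl, rfl⟩)
    · exact ⟨_, _, hne.1, hne.2, h₁, h₂, h₃, h₄, by ext; simp⟩
    · exact ⟨_, _, hne.2, hne.1, h₁.symm, h₄.symm, h₃.symm, h₂.symm,
        by ext; simp [Sym2.eq_swap]; tauto⟩
    · exact ⟨_, _, hne.2, hne.1.symm, h₂, h₃, h₄, h₁, by ext; simp; tauto⟩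
    · exact ⟨_, _, hne.1.symm, hne.2, h₂.symm, h₁.symm, h₄.symm, h₃.symm,
        by ext; simp [Sym2.eq_swap]; tauto⟩
    · exact ⟨_, _, hne.1.symm, hne.2.symm, h₃, h₄, h₁, h₂, by ext; simp; tauto⟩
    · exact ⟨_, _, hne.2.symm, hne.1.symm, h₃.symm, h₂.symm, h₁.symm, h₄.symm,
        by ext; simp [Sym2.eq_swap]; tauto⟩
    · exact ⟨_, _, hne.2.symm, hne.1, h₄, h₁, h₂, h₃, by ext; simp; tauto⟩
    · exact ⟨_, _, hne.1, hne.2.symm, h₄.symm, h₃.symm, h₂.symm, h₁.symm,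
        by ext; simp [Sym2.eq_swap]; tauto⟩

lemma exists_isCycle_four {a b c d : V} (h₁ : G.Adj a b) (h₂ : G.Adj b c) (h₃ : G.Adj c d)
    (h₄ : G.Adj d a) (hn : [a, b, c, d].Nodup) : ∃ w : G.Walk a a, w.IsCycle ∧ w.length = 4 := by
  refine ⟨.cons h₁ (.cons h₂ (.cons h₃ (.cons h₄ .nil))), ?_, rfl⟩
  rw [Walk.cons_isCycle_iff]
  simp only [List.nodup_cons, List.mem_cons, List.not_mem_nil, not_or] at hn
  refine ⟨?_, ?_⟩
  · simp [Walk.isPath_def]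
    grind
  · simp
    grind

lemma exists_isCycle_five {a b c d e : V} (h₁ : G.Adj a b) (h₂ : G.Adj b c) (h₃ : G.Adj c d)
    (h₄ : G.Adj d e) (h₅ : G.Adj e a) (hn : [a, b, c, d, e].Nodup) :
    ∃ w : G.Walk a a, w.IsCycle ∧ w.length = 5 := by
  refine ⟨.cons h₁ (.cons h₂ (.cons h₃ (.cons h₄ (.cons h₅ .nil)))), ?_, rfl⟩
  rw [Walk.cons_isCycle_iff]
  simp only [List.nodup_cons, List.mem_cons, List.not_mem_nil, not_or] at hn
  refine ⟨?_, ?_⟩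
  · simp [Walk.isPath_def]
    grind
  · simp
    grind

lemma exists_isCycle_six {a b c d e f : V} (h₁ : G.Adj a b) (h₂ : G.Adj b c) (h₃ : G.Adj c d)
    (h₄ : G.Adj d e) (h₅ : G.Adj e f) (h₆ : G.Adj f a) (hn : [a, b, c, d, e, f].Nodup) :
    ∃ w : G.Walk a a, w.IsCycle ∧ w.length = 6 := by
  refine ⟨.cons h₁ (.cons h₂ (.cons h₃ (.cons h₄ (.cons h₅ (.cons h₆ .nil))))), ?_, rfl⟩
  rw [Walk.cons_isCycle_iff]
  simp only [List.nodup_cons, List.mem_cons, List.not_mem_nil, not_or] at hn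
  refine ⟨?_, ?_⟩
  · simp [Walk.isPath_def]
    grind
  · simp
    grind

/-- A graph contains no diamond, that is, no `4`-cycle with a chord. -/
def DiamondFree (G : SimpleGraph V) : Prop :=
  ∀ a b c d, b ≠ d → G.Adj a b → G.Adj b c → G.Adj c d → G.Adj d a → ¬ G.Adj a c

namespace SideSystem

variable {M : Type*} (S : G.SideSystem M)

/-- The graph formed by the edges with a given side. -/
def boundary (φ : M) : SimpleGraph V where
  Adj u v := G.Adj u v ∧ φ ∈ S.sides s(u, v)
  symm := ⟨fun u _ h => ⟨h.1.symm, Sym2.eq_swap (a := u) ▸ h.2⟩⟩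
  loopless := ⟨fun _ h => h.1.ne rfl⟩

lemma boundary_le (φ : M) : S.boundary φ ≤ G := fun _ _ h => h.1

lemma mem_sides_of_mem_edgeSet {φ : M} {e : Sym2 V} (he : e ∈ (S.boundary φ).edgeSet) :
    φ ∈ S.sides e := by
  induction e using Sym2.ind with
  | _ u v => exact he.2

variable (h3 : ∀ v, (G.neighborSet v).ncard = 3)
include h3

/-- An even positive number that is at most 3 equals 2. -/
lemma isCycles_boundary [Finite V] (φ : M) : (S.boundary φ).IsCycles := by
  intro v hv
  have h1 := S.even v φ
  have h2 : ((S.boundary φ).neighborSet v).ncard ≤ 3 := by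
    rw [← h3 v]
    exact Set.ncard_le_ncard (fun x hx => hx.1) (Set.toFinite _)
  have h4 := (Set.ncard_pos (Set.toFinite _)).2 hv
  change Even ((S.boundary φ).neighborSet v).ncard at h1
  obtain ⟨m, hm⟩ := h1
  omega

lemma mem_sides_of_ne {v x y z : V} (hx : G.Adj v x) (hy : G.Adj v y) (hz : G.Adj v z)
    (hxy : x ≠ y) (hxz : x ≠ z) (hyz : y ≠ z) {φ : M} :
    φ ∈ S.sides s(v, z) ↔ ¬ (φ ∈ S.sides s(v, x) ↔ φ ∈ S.sides s(v, y)) := by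
  classical
  obtain ⟨z', hz'x, hz'y, hn⟩ := exists_third_neighbor h3 hx hy hxy
  obtain rfl : z = z' := by
    rcases (hn z).1 hz with h | h | h
    · exact absurd h.symm hxz
    · exact absurd h.symm hyz
    · exact h
  have h := S.even v φ
  have hset : {w | G.Adj v w ∧ φ ∈ S.sides s(v, w)} =
      (({x, y, z} : Finset V).filter fun w => φ ∈ S.sides s(v, w) : Finset V) := by
    ext w
    simp [hn]
  rw [hset, Set.ncard_coe_finset] at h
  by_cases h1 : φ ∈ S.sides s(v, x) <;> by_cases h2 : φ ∈ S.sides s(v, y) <;>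
    by_cases h4 : φ ∈ S.sides s(v, z) <;>
    simp [Finset.filter_insert, Finset.filter_singleton, h1, h2, h4, hxy, hxz, hyz] at h ⊢
  all_goals exact absurd h (by decide)

/-- Two edges at `v` with the same pair of sides would, by parity, leave the third edge without any
side. -/
lemma eq_of_mem_sides {v x y : V} (hx : G.Adj v x) (hy : G.Adj v y) (hxy : x ≠ y) {φ ψ : M}
    (hφx : φ ∈ S.sides s(v, x)) (hψx : ψ ∈ S.sides s(v, x)) (hφy : φ ∈ S.sides s(v, y))
    (hψy : ψ ∈ S.sides s(v, y)) : φ = ψ := by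
  classical
  by_contra hne
  have hpair : ∀ e ∈ G.edgeSet, φ ∈ S.sides e → ψ ∈ S.sides e → S.sides e = {φ, ψ} := by
    intro e he h1 h2
    refine (Finset.eq_of_subset_of_card_le ?_ ?_).symm
    · intro χ hχ
      rcases Finset.mem_insert.1 hχ with rfl | hχ
      · exact h1
      · rwa [Finset.mem_singleton.1 hχ]
    · rw [S.card_sides e he, Finset.card_pair hne]
  obtain ⟨z, hzx, hzy, hn⟩ := exists_third_neighbor h3 hx hy hxy
  have hz : G.Adj v z := (hn z).2 (Or.inr (Or.inr rfl))
  have hcard := S.card_sides s(v, z) hz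
  obtain ⟨χ, hχ⟩ : (S.sides s(v, z)).Nonempty := by
    rw [← Finset.card_pos, hcard]
    exact two_pos
  rw [S.mem_sides_of_ne h3 hx hy hz hxy hzx.symm hzy.symm, hpair _ hx hφx hψx,
    hpair _ hy hφy hψy] at hχ
  exact hχ Iff.rfl

omit h3 in
lemma exists_isCycle_boundary [Finite V] (hcyc : ∀ φ, (S.boundary φ).IsCycles) {φ : M} {e : Sym2 V}
    (he : e ∈ G.edgeSet) (hφ : φ ∈ S.sides e) :
    ∃ (u : V) (w : (S.boundary φ).Walk u u), w.IsCycle := by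
  induction e using Sym2.ind with
  | _ u v =>
    obtain ⟨w, hw, -⟩ := (hcyc φ).exists_cycle_toSubgraph_verts_eq_connectedComponentSupp
      (c := (S.boundary φ).connectedComponentMk u) (v := u) rfl ⟨v, he, hφ⟩
    exact ⟨u, w, hw⟩

/-- At each end of the common edge `ab` the two cycles diverge, as different boundaries share at
most one edge there. Leaving out `ab`, two triangles give a diamond, a triangle and a 4-cycle give a
5-cycle, and two 4-cycles give a 6-cycle. -/
lemma disjoint_of_isShortCycleAt [DecidableEq V] (hd : G.DiamondFree)
    (h56 : ∀ (u : V) (w : G.Walk u u), w.IsCycle → w.length ≠ 5 ∧ w.length ≠ 6) {φ ψ : M}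
    (hne : φ ≠ ψ) {T T' : Finset (Sym2 V)} {a b : V} (hT : (S.boundary φ).IsShortCycleAt T a b)
    (hT' : (S.boundary ψ).IsShortCycleAt T' a b) : False := by
  have key : ∀ v x y y', (S.boundary φ).Adj v x → (S.boundary ψ).Adj v x →
      (S.boundary φ).Adj v y → (S.boundary ψ).Adj v y' → y ≠ x → y ≠ y' := by
    rintro v x y _ h1 h2 h3' h4 hyx rfl
    exact hne (S.eq_of_mem_sides h3 h1.1 h3'.1 hyx.symm h1.2 h2.2 h3'.2 h4.2)
  rcases hT with ⟨c, ab, bc, ca, -⟩ | ⟨c, d, hac, hbd, ab, bc, cd, da, -⟩ <;>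
    rcases hT' with ⟨c', ab', bc', ca', -⟩ | ⟨c', d', hac', hbd', ab', bc', cd', da', -⟩
  · have h1 := key b a c c' ab.symm ab'.symm bc bc' ca.ne
    exact hd a c b c' h1 ca.1.symm bc.1.symm bc'.1 ca'.1 ab.1
  · have h1 := key b a c c' ab.symm ab'.symm bc bc' ca.ne
    have h2 := key a b c d' ab ab' ca.symm da'.symm bc.ne'
    obtain ⟨w, hw, hl⟩ := exists_isCycle_five ca.1.symm bc.1.symm bc'.1 cd'.1 da'.1 (by
      have := ab.ne; have := bc.ne; have := ca.ne; have := bc'.ne; have := cd'.ne; have := da'.ne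
      simp; grind)
    exact (h56 _ w hw).1 hl
  · have h1 := key b a c c' ab.symm ab'.symm bc bc' hac.symm
    have h2 := key a b d c' ab ab' da.symm ca'.symm hbd.symm
    obtain ⟨w, hw, hl⟩ := exists_isCycle_five ca'.1.symm bc'.1.symm bc.1 cd.1 da.1 (by
      have := ab.ne; have := bc.ne; have := ca'.ne; have := bc'.ne; have := cd.ne; have := da.ne
      simp; grind)
    exact (h56 _ w hw).1 hl
  · have h1 := key b a c c' ab.symm ab'.symm bc bc' hac.symm
    have h2 := key a b d d' ab ab' da.symm da'.symm hbd.symm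
    -- The only possible coincidences among the remaining vertices make one 4-cycle provide a chord
    -- of the other.
    by_cases hcd' : c = d'
    · subst hcd'
      exact hd a b c d hbd ab.1 bc.1 cd.1 da.1 da'.1.symm
    by_cases hdc' : d = c'
    · subst hdc'
      exact hd b a d c hac ab.1.symm da.1.symm cd.1.symm bc.1.symm bc'.1
    obtain ⟨w, hw, hl⟩ := exists_isCycle_six bc.1 cd.1 da.1 da'.1.symm cd'.1.symm bc'.1.symm (by
      have := ab.ne; have := bc.ne; have := cd.ne; have := da.ne; have := bc'.ne
      have := cd'.ne; have := da'.ne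
      simp; grind)
    exact (h56 _ w hw).2 hl

end SideSystem

end SimpleGraph

/-! ### Counting edges on short and long boundaries -/

namespace SimpleGraph

universe u

variable {V : Type u} {G : SimpleGraph V}

lemma Walk.IsCycle.card_support_tail_toFinset [DecidableEq V] {u : V} {w : G.Walk u u}
    (hw : w.IsCycle) : w.support.tail.toFinset.card = w.length := by
  rw [List.toFinset_card_of_nodup hw.support_nodup, List.length_tail, Walk.length_support,
    Nat.add_sub_cancel]

lemma Walk.IsCycle.length_le_card [Fintype V] {u : V} {w : G.Walk u u} (hw : w.IsCycle) :
    w.length ≤ Fintype.card V := by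
  classical
  rw [← hw.card_support_tail_toFinset]
  exact Finset.card_le_univ _

lemma Walk.IsCycle.card_edges_toFinset [DecidableEq V] {u : V} {w : G.Walk u u}
    (hw : w.IsCycle) : w.edges.toFinset.card = w.length := by
  rw [List.toFinset_card_of_nodup hw.edges_nodup, Walk.length_edges]

/-- A matching contained in a cycle has at most half as many edges as the cycle. -/
lemma Walk.IsCycle.two_mul_card_le [DecidableEq V] {u : V} {w : G.Walk u u} (hw : w.IsCycle)
    {T : Finset (Sym2 V)} (hT : ∀ e ∈ T, e ∈ w.edges)
    (hd : ∀ v x y, s(v, x) ∈ T → s(v, y) ∈ T → x = y) : 2 * T.card ≤ w.length := by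
  have hdisj : (T : Set (Sym2 V)).PairwiseDisjoint Sym2.toFinset := by
    intro e he e' he' hne
    rw [Function.onFun, Finset.disjoint_left]
    intro v hv hv'
    rw [Sym2.mem_toFinset] at hv hv'
    obtain ⟨x, rfl⟩ := Sym2.mem_iff_exists.1 hv
    obtain ⟨y, rfl⟩ := Sym2.mem_iff_exists.1 hv'
    exact hne (by rw [hd v x y he he'])
  have h2 : ∀ e ∈ T, e.toFinset.card = 2 := fun e he =>
    Sym2.card_toFinset_of_not_isDiag e (G.not_isDiag_of_mem_edgeSet
      (w.edges_subset_edgeSet (hT e he)))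
  rw [← hw.card_support_tail_toFinset, mul_comm, ← Finset.sum_const_nat h2,
    ← Finset.card_biUnion hdisj]
  refine Finset.card_le_card fun v hv => ?_
  obtain ⟨e, he, hv⟩ := Finset.mem_biUnion.1 hv
  rw [Sym2.mem_toFinset] at hv
  obtain ⟨x, rfl⟩ := Sym2.mem_iff_exists.1 hv
  rw [List.mem_toFinset]
  rcases w.mem_support_iff.1 (w.fst_mem_support_of_mem_edges (hT _ he)) with rfl | h
  · exact Walk.end_mem_tail_support hw.not_nil
  · exact h

namespace SideSystem

variable {M : Type*} (S : G.SideSystem M)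

/-- Let `S` be a side system of a finite cubic graph without diamonds, without cycles of length `5`
or `6` and, if there is a cycle of length at most `4`, without cycles of a length between `5` and
`10`. Then the average boundary has at least six edges. -/
theorem six_mul_card_le [Finite V] (h3 : ∀ v, (G.neighborSet v).ncard = 3) (hd : G.DiamondFree)
    (h56 : ∀ (u : V) (w : G.Walk u u), w.IsCycle → w.length ≠ 5 ∧ w.length ≠ 6)
    (h11 : (∃ (u : V) (w : G.Walk u u), w.IsCycle ∧ w.length ≤ 4) →
      ∀ (u : V) (w : G.Walk u u), w.IsCycle → w.length ≤ 4 ∨ 11 ≤ w.length)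
    (Φ : Finset M) (hΦ : ∀ φ ∈ Φ, ∃ e ∈ G.edgeSet, φ ∈ S.sides e) :
    6 * Φ.card ≤ 2 * Nat.card G.edgeSet := by
  classical
  have := Fintype.ofFinite V
  let Short : M → Prop := fun φ => ∃ (u : V) (w : (S.boundary φ).Walk u u),
    w.IsCycle ∧ w.length ≤ 4
  have hT : ∀ φ, ∃ T : Finset (Sym2 V), Short φ → 3 ≤ T.card ∧
      (∀ a b, s(a, b) ∈ T → (S.boundary φ).IsShortCycleAt T a b) ∧
      ∀ e ∈ T, e ∈ (S.boundary φ).edgeSet := by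
    intro φ
    by_cases h : Short φ
    · obtain ⟨u, w, hw, hl⟩ := h
      refine ⟨w.edges.toFinset, fun _ => ⟨?_, fun a b hab => ?_, fun e he => ?_⟩⟩
      · rw [hw.card_edges_toFinset]
        exact hw.three_le_length
      · exact hw.isShortCycleAt hl (List.mem_toFinset.1 hab)
      · exact w.edges_subset_edgeSet (List.mem_toFinset.1 he)
    · exact ⟨∅, fun h' => absurd h' h⟩
  choose T hT using hT
  set Φ₀ := Φ.filter Short with hΦ₀
  have hdisj : ∀ φ ψ, Short φ → Short ψ → φ ≠ ψ → ∀ e ∈ T φ, e ∉ T ψ := by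
    intro φ ψ hφ hψ hne e
    induction e using Sym2.ind with
    | _ a b =>
      exact fun h h' => S.disjoint_of_isShortCycleAt h3 hd h56 hne ((hT φ hφ).2.1 a b h)
        ((hT ψ hψ).2.1 a b h')
  set E : Finset (Sym2 V) := G.edgeSet.toFinset with hE
  set N := Φ₀.biUnion T with hN
  have hNE : N ⊆ E := by
    intro e he
    obtain ⟨φ, hφ, he⟩ := Finset.mem_biUnion.1 he
    have := (hT φ (Finset.mem_filter.1 hφ).2).2.2 e he
    exact Set.mem_toFinset.2 (edgeSet_mono (S.boundary_le φ) this)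
  have hNcard : 3 * Φ₀.card ≤ N.card := by
    rw [hN, Finset.card_biUnion, mul_comm]
    · exact Finset.card_nsmul_le_sum _ _ _ fun φ hφ => (hT φ (Finset.mem_filter.1 hφ).2).1
    · intro φ hφ ψ hψ hne
      rw [Function.onFun, Finset.disjoint_left]
      exact hdisj φ ψ (Finset.mem_filter.1 hφ).2 (Finset.mem_filter.1 hψ).2 hne
  -- If the short cycles of `ψ` and `χ` used the edges `vx` and `vy` of `φ`, each would have to
  -- continue along the third edge `vz`, as it cannot share two edges at `v` with `φ`. Then `ψ = χ`,
  -- which shares both `vx` and `vy` with `φ`.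
  have hmatch : ∀ φ ∈ Φ, ¬ Short φ → ∀ v x y, (S.boundary φ).Adj v x → (S.boundary φ).Adj v y →
      s(v, x) ∈ N → s(v, y) ∈ N → x = y := by
    intro φ hφ hφs v x y hx hy hxN hyN
    by_contra hxy
    obtain ⟨ψ, hψ, hxψ⟩ := Finset.mem_biUnion.1 hxN
    obtain ⟨χ, hχ, hyχ⟩ := Finset.mem_biUnion.1 hyN
    replace hψ := (Finset.mem_filter.1 hψ).2
    replace hχ := (Finset.mem_filter.1 hχ).2
    have hφψ : φ ≠ ψ := by rintro rfl; exact hφs hψ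
    have hφχ : φ ≠ χ := by rintro rfl; exact hφs hχ
    obtain ⟨z, hzx, hzy, hn⟩ := exists_third_neighbor h3 hx.1 hy.1 hxy
    have aux : ∀ ψ x y, Short ψ → φ ≠ ψ → x ≠ y → (S.boundary φ).Adj v x →
        (S.boundary φ).Adj v y → (∀ w, G.Adj v w → w = x ∨ w = y ∨ w = z) → s(v, x) ∈ T ψ →
        s(v, z) ∈ T ψ := by
      intro ψ x y hψ hφψ hxy hx hy hn hxT
      obtain ⟨c, hcx, hc, hcT⟩ := ((hT ψ hψ).2.1 v x hxT).exists_ne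
      rcases hn c hc.1 with rfl | rfl | rfl
      · exact absurd rfl hcx
      · exact absurd (S.eq_of_mem_sides h3 hx.1 hy.1 hxy hx.2
          (S.mem_sides_of_mem_edgeSet ((hT ψ hψ).2.2 _ hxT)) hy.2 hc.2) hφψ
      · exact hcT
    have h1 := aux ψ x y hψ hφψ hxy hx hy (fun w hw => (hn w).1 hw) hxψ
    have h2 := aux χ y x hχ hφχ (Ne.symm hxy) hy hx
      (fun w hw => by have := (hn w).1 hw; tauto) hyχ
    by_cases hψχ : ψ = χ
    · subst hψχ
      exact hφψ (S.eq_of_mem_sides h3 hx.1 hy.1 hxy hx.2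
        (S.mem_sides_of_mem_edgeSet ((hT ψ hψ).2.2 _ hxψ)) hy.2
        (S.mem_sides_of_mem_edgeSet ((hT ψ hψ).2.2 _ hyχ)))
    · exact hdisj ψ χ hψ hχ hψχ _ h1 h2
  have hlong : ∀ φ ∈ Φ, ¬ Short φ →
      6 ≤ (Finset.bipartiteAbove (fun φ e => φ ∈ S.sides e) (E \ N) φ).card := by
    intro φ hφ hφs
    obtain ⟨e, he, hφe⟩ := hΦ φ hφ
    obtain ⟨u, w, hw⟩ := S.exists_isCycle_boundary (S.isCycles_boundary h3) he hφe
    have hw5 : 5 ≤ w.length := by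
      by_contra! h
      exact hφs ⟨u, w, hw, by omega⟩
    have hwG := hw.mapLe (S.boundary_le φ)
    have h7 := h56 u _ hwG
    rw [Walk.length_map] at h7
    have hsub : w.edges.toFinset \ N ⊆
        Finset.bipartiteAbove (fun φ e => φ ∈ S.sides e) (E \ N) φ := by
      intro e he
      rw [Finset.mem_sdiff, List.mem_toFinset] at he
      have := w.edges_subset_edgeSet he.1
      rw [Finset.mem_bipartiteAbove, Finset.mem_sdiff]
      exact ⟨⟨Set.mem_toFinset.2 (edgeSet_mono (S.boundary_le φ) this), he.2⟩,
        S.mem_sides_of_mem_edgeSet this⟩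
    refine le_trans ?_ (Finset.card_le_card hsub)
    have hcard := Finset.card_sdiff_add_card_inter w.edges.toFinset N
    rw [hw.card_edges_toFinset] at hcard
    -- Without short faces `N` is empty and the cycle has length at least 7. Otherwise its length is
    -- at least 11 and at most half of it lies in `N`, so at least six edges remain.
    rcases Φ₀.eq_empty_or_nonempty with h0 | ⟨ψ, hψ⟩
    · have : N = ∅ := by rw [hN, h0, Finset.biUnion_empty]
      rw [this, Finset.inter_empty, Finset.card_empty] at hcard
      rw [this]
      omega
    · obtain ⟨u', w', hw', hl'⟩ := (Finset.mem_filter.1 hψ).2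
      have h := h11 ⟨u', _, hw'.mapLe (S.boundary_le ψ), by rwa [Walk.length_map]⟩ u _ hwG
      rw [Walk.length_map] at h
      have h2 := hw.two_mul_card_le (T := w.edges.toFinset ∩ N)
        (fun e he => List.mem_toFinset.1 (Finset.mem_inter.1 he).1) (fun v x y hx hy => by
          rw [Finset.mem_inter, List.mem_toFinset] at hx hy
          exact hmatch φ hφ hφs v x y (w.edges_subset_edgeSet hx.1) (w.edges_subset_edgeSet hy.1)
            hx.2 hy.2)
      omega
  have hcount := Finset.sum_card_bipartiteAbove_eq_sum_card_bipartiteBelow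
    (s := Φ.filter fun φ => ¬ Short φ) (t := E \ N) (fun φ e => φ ∈ S.sides e)
  have hle := Finset.card_nsmul_le_sum (Φ.filter fun φ => ¬ Short φ)
    (fun φ => (Finset.bipartiteAbove (fun φ e => φ ∈ S.sides e) (E \ N) φ).card) 6
    fun φ hφ => hlong φ (Finset.mem_filter.1 hφ).1 (Finset.mem_filter.1 hφ).2
  have hge := Finset.sum_le_card_nsmul (E \ N)
    (fun e => (Finset.bipartiteBelow (fun φ e => φ ∈ S.sides e)
      (Φ.filter fun φ => ¬ Short φ) e).card) 2 fun e he => by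
      rw [← S.card_sides e (Set.mem_toFinset.1 (Finset.mem_sdiff.1 he).1)]
      refine Finset.card_le_card fun φ hφ => ?_
      exact ((Finset.mem_bipartiteBelow _).1 hφ).2
  have h₁ := Finset.card_sdiff_add_card_eq_card hNE
  have h₂ := Finset.card_filter_add_card_filter_not (s := Φ) Short
  have h₃ : Nat.card G.edgeSet = E.card := by
    rw [hE, Set.toFinset_card, Nat.card_eq_fintype_card]
  rw [← hΦ₀] at h₂
  simp only [smul_eq_mul] at hle hge
  -- Short faces satisfy 6|Φ₀| ≤ 2|N|, and the others are charged to the edges outside `N`, each of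
  -- which has two sides.
  omega

end SideSystem

/-- A planar cubic graph without bridges and diamonds has a cycle of length `5` or `6`, or a cycle
of length at most `4` and a cycle of a length between `5` and `10`. -/
theorem IsPlanar.exists_isCycle_of_cubic [Fintype V] [Nonempty V] (hG : G.IsPlanar)
    (h3 : ∀ v, (G.neighborSet v).ncard = 3) (hb : ∀ e ∈ G.edgeSet, ¬ G.IsBridge e)
    (hd : G.DiamondFree) :
    (∃ (u : V) (w : G.Walk u u), w.IsCycle ∧ (w.length = 5 ∨ w.length = 6)) ∨
    (∃ (u : V) (w : G.Walk u u), w.IsCycle ∧ w.length ≤ 4) ∧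
      ∃ (u : V) (w : G.Walk u u), w.IsCycle ∧ 5 ≤ w.length ∧ w.length ≤ 10 := by
  classical
  have he : G.edgeSet.Nonempty := by
    obtain ⟨v⟩ := ‹Nonempty V›
    obtain ⟨x, hx⟩ := Set.nonempty_of_ncard_ne_zero (s := G.neighborSet v) (by rw [h3]; norm_num)
    exact ⟨s(v, x), hx⟩
  obtain ⟨M, S, Φ, -, hΦ, hcard⟩ := hG.exists_sideSystem hb he
  by_contra! h
  have h6 := S.six_mul_card_le h3 hd (fun u w hw => h.1 u w hw) (fun hs u w hw => by
    have := h.2 hs u w hw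
    omega) Φ hΦ
  have hdeg := G.sum_degrees_eq_twice_card_edges
  have hdeg3 : ∀ v ∈ Finset.univ, G.degree v = 3 := by
    intro v _
    rw [← h3 v, ← card_neighborFinset_eq_degree, ← Set.ncard_coe_finset, coe_neighborFinset]
  rw [Finset.sum_const_nat hdeg3, Finset.card_univ] at hdeg
  have : Nat.card G.edgeSet = G.edgeFinset.card := by
    rw [Nat.card_eq_fintype_card, edgeFinset_card]
  -- Here 3V = 2E, E + 2 ≤ V + F and 3F ≤ E are incompatible.
  omega

/-! ### Consequences of 3-connectedness -/

section Connected

variable [Fintype V]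

/-- Another neighbour `x` of `u` is joined to `v` in the graph without `u`, which bypasses the edge
`uv`. -/
lemma IsKConnected.not_isBridge (hG : G.IsKConnected 3) (h3 : ∀ v, (G.neighborSet v).ncard = 3) :
    ∀ e ∈ G.edgeSet, ¬ G.IsBridge e := by
  intro e he
  induction e using Sym2.ind with
  | _ u v =>
    rw [isBridge_iff, not_not]
    obtain ⟨x, hx, hxv⟩ := Set.exists_ne_of_one_lt_ncard (s := G.neighborSet u)
      (by rw [h3]; norm_num) v
    have hc := hG.2 {u} (by simp)
    have hxu : x ≠ u := hx.ne'
    have hvu : v ≠ u := he.ne'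
    have hreach := hc.preconnected ⟨x, by simpa using hxu⟩ ⟨v, by simpa using hvu⟩
    let f : G.induce {w | w ∉ ({u} : Finset V)} →g G.deleteEdges {s(u, v)} :=
      { toFun := Subtype.val
        map_rel' := by
          rintro ⟨a, ha⟩ ⟨b, hb⟩ hab
          simp only [Finset.mem_singleton, Set.mem_ofPred_eq] at ha hb
          rw [deleteEdges_adj]
          refine ⟨hab, fun h => ?_⟩
          rcases Sym2.eq_iff.1 (Set.mem_singleton_iff.1 h) with h | h
          · exact ha h.1
          · exact hb h.2 }
    have hux : (G.deleteEdges {s(u, v)}).Adj u x := by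
      rw [deleteEdges_adj]
      refine ⟨hx, fun h => hxv ?_⟩
      exact Sym2.congr_right.1 (Set.mem_singleton_iff.1 h)
    exact hux.reachable.trans (hreach.map f)

/-- With the chord `ac`, the vertices `a` and `c` have no neighbours outside the diamond, so
deleting `b` and `d` separates them from any fifth vertex. -/
lemma IsKConnected.diamondFree (hG : G.IsKConnected 3) (h3 : ∀ v, (G.neighborSet v).ncard = 3)
    (hV : 5 ≤ Fintype.card V) : G.DiamondFree := by
  classical
  intro a b c d hbd hab hbc hcd hda hac
  obtain ⟨e, he⟩ : ∃ e, e ∉ ({a, b, c, d} : Finset V) := by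
    by_contra! h
    have h1 := Finset.card_le_card (fun v _ => h v : Finset.univ ⊆ ({a, b, c, d} : Finset V))
    have h2 := Finset.card_le_four (a := a) (b := b) (c := c) (d := d)
    rw [Finset.card_univ] at h1
    omega
  have hna : ∀ w, G.Adj a w → w = b ∨ w = c ∨ w = d := by
    obtain ⟨z, hzb, hzd, hn⟩ := exists_third_neighbor h3 hab hda.symm hbd
    rcases (hn c).1 hac with rfl | rfl | rfl
    · exact absurd rfl hbc.ne
    · exact absurd rfl hcd.ne
    · intro w hw
      have := (hn w).1 hw
      tauto
  have hnc : ∀ w, G.Adj c w → w = b ∨ w = a ∨ w = d := by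
    obtain ⟨z, hzb, hzd, hn⟩ := exists_third_neighbor h3 hbc.symm hcd hbd
    rcases (hn a).1 hac.symm with rfl | rfl | rfl
    · exact absurd rfl hab.ne
    · exact absurd rfl hda.ne
    · intro w hw
      have := (hn w).1 hw
      tauto
  have hc := hG.2 {b, d} (Finset.card_le_two.trans_lt (by norm_num))
  have ha : a ∉ ({b, d} : Finset V) := by simp [hab.ne, hda.ne']
  have he' : e ∉ ({b, d} : Finset V) := by simp at he ⊢; tauto
  obtain ⟨w⟩ := hc.preconnected ⟨a, ha⟩ ⟨e, he'⟩
  have key : ∀ (p q : {v : V | v ∉ ({b, d} : Finset V)})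
      (_ : (G.induce {v : V | v ∉ ({b, d} : Finset V)}).Walk p q), p.1 = a ∨ p.1 = c →
      q.1 = a ∨ q.1 = c := by
    intro p q w
    induction w with
    | nil => exact id
    | @cons p r q h w ih =>
      intro hp
      refine ih ?_
      have hr := r.2
      simp only [Set.mem_ofPred_eq, Finset.mem_insert, Finset.mem_singleton, not_or] at hr
      have h' : G.Adj p.1 r.1 := h
      rcases hp with hp | hp
      · rw [hp] at h'
        have := hna _ h'
        tauto
      · rw [hp] at h'
        have := hnc _ h'
        tauto
  have := key _ _ w (Or.inl rfl)
  simp at he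
  tauto

lemma circumference_le_card : G.circumference ≤ Fintype.card V := by
  refine iSup₂_le fun n hn => ?_
  obtain ⟨v, w, hw, rfl⟩ := hn
  exact_mod_cast hw.length_le_card

end Connected

end SimpleGraph

/-! ### The four values of k -/

theorem mainTheorem2 {V : Type*} [Fintype V] (G : SimpleGraph V) [DecidableRel G.Adj]
    (h_connected : G.IsKConnected 3) (h_cubic : G.IsRegularOfDegree 3) (h_planar : G.IsPlanar)
    (k : ℕ) (hk : k ∈ ({2, 3, 4, 5} : Set ℕ)) (h_circ : (k : ℕ∞) ≤ G.circumference) :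
    (G.cycleSpectrum ∩ Set.Icc k (2 * k + 2)).Nonempty := by
  by_contra hempty
  have hno : ∀ (u : V) (w : G.Walk u u), w.IsCycle → w.length < k ∨ 2 * k + 2 < w.length := by
    intro u w hw
    by_contra! h
    exact hempty ⟨w.length, ⟨u, w, hw, rfl⟩, h⟩
  have h3 : ∀ v, (G.neighborSet v).ncard = 3 := by
    intro v
    rw [← h_cubic v, ← SimpleGraph.card_neighborFinset_eq_degree, ← Set.ncard_coe_finset,
      SimpleGraph.coe_neighborFinset]
  have hcard : 3 < Fintype.card V := h_connected.1
  have : Nonempty V := Fintype.card_pos_iff.1 (by omega)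
  -- For k ≤ 4 a diamond already contains a 4-cycle of admissible length. Only k = 5 needs the
  -- circumference, to have a fifth vertex and so exclude `K₄`.
  have hd : G.DiamondFree := by
    by_cases hk5 : k = 5
    · subst hk5
      exact h_connected.diamondFree h3 (by exact_mod_cast h_circ.trans G.circumference_le_card)
    · intro a b c d hbd hab hbc hcd hda hac
      obtain ⟨w, hw, hl⟩ := SimpleGraph.exists_isCycle_four hab hbc hcd hda (by
        simp [hab.ne, hac.ne, hda.ne', hbc.ne, hbd, hcd.ne])
      have := hno a w hw
      simp only [Set.mem_insert_iff, Set.mem_singleton_iff] at hk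
      omega
  simp only [Set.mem_insert_iff, Set.mem_singleton_iff] at hk
  -- Lengths 5 and 6 lie in all four intervals. In the other case the cycle of length 3 or 4 serves
  -- k = 2, 3, and the one of length 5 to 10 serves k = 4, 5.
  rcases h_planar.exists_isCycle_of_cubic h3 (h_connected.not_isBridge h3) hd with
    ⟨u, w, hw, hl⟩ | ⟨⟨u, w, hw, hl⟩, u', w', hw', hl₁, hl₂⟩
  · have := hno u w hw
    omega
  · have h₁ := hno u w hw
    have h₂ := hno u' w' hw'
    have h₃ := hw.three_le_length
    omega
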